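/- Let $n\ge 2$ and $1<p<\infty$. Let $F:\mathbb{R}^n\to[0,\infty)$ be a Finsler norm, i.e. a convex function with $F(t\xi)=|t|F(\xi)$ for all $t\in\mathbb{R}$, $\xi\in\mathbb{R}^n$, and $a|\xi|\le F(\xi)$ for all $\xi$ and some constant $a>0$. Assume that $F\in C^2(\mathbb{R}^n\setminus\{0\})$ and that the Hessian matrix of $F^p$ is positive definite at every point of $\mathbb{R}^n\setminus\{0\}$. Let $$F^o(v)=\sup_{\xi\neq 0}\frac{\langle \xi,v\rangle}{F(\xi)}$$ be the polar function of $F$. For a nonempty bounded open convex set $\Omega\subset\mathbb{R}^n$ with outward unit normal $\nu_{\partial\Omega}$ (defined $\mathcal{H}^{n-1}$-almost everywhere on $\partial\Omega$) and Lebesgue measure $V(\Omega)$, put $$P_F(\Omega)=\int_{\partial\Omega}F(\nu_{\partial\Omega})\,d\mathcal{H}^{n-1},\qquad M_F(\Omega)=\int_{\partial\Omega}[F^o(x)]^p\,F(\nu_{\partial\Omega}(x))\,d\mathcal{H}^{n-1}(x),$$ $$\mathcal{F}(\Omega)=\frac{M_F(\Omega)}{P_F(\Omega)\,V(\Omega)^{p/n}},\qquad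 r^F_{\max}(\Omega)=\max_{x\in\overline{\Omega}}F^o(x),$$ and define the anisotropic $p$-excess of $\Omega$ by $$E_F(\Omega)=\bigl(r^F_{\max}(\Omega)\bigr)^{p-1}-\frac{M_F(\Omega)}{n\,V(\Omega)}.$$ If $\Omega$ is a nonempty bounded open convex set with $E_F(\Omega)>0$, then $\Omega$ is not a minimizer of $\mathcal{F}$ among the nonempty bounded open convex subsets of $\mathbb{R}^n$; that is, there is a nonempty bounded open convex set $\Omega'\subset\mathbb{R}^n$ with $\mathcal{F}(\Omega')<\mathcal{F}(\Omega)$. -/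

import Mathlib

open MeasureTheory Set

noncomputable section

/-- `F` is a Finsler norm on `ℝⁿ` which is `C²` away from the origin and for which the Hessian of
`F ^ p` is positive definite at every point of `ℝⁿ \ {0}`. -/
structure IsFinslerNorm {n : ℕ} (p : ℝ) (F : EuclideanSpace ℝ (Fin n) → ℝ) : Prop where
  nonneg : ∀ ξ, 0 ≤ F ξ
  convex : ConvexOn ℝ univ F
  homogeneous : ∀ (t : ℝ) (ξ : EuclideanSpace ℝ (Fin n)), F (t • ξ) = |t| * F ξ
  coercive : ∃ a : ℝ, 0 < a ∧ ∀ ξ, a * ‖ξ‖ ≤ F ξ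
  contDiffOn : ContDiffOn ℝ 2 F {0}ᶜ
  hessian_pos : ∀ ξ, ξ ≠ 0 → ∀ v, v ≠ 0 → 0 < fderiv ℝ (fderiv ℝ (fun x => F x ^ p)) ξ v v

/-- The polar function `F°(v) = sup_{ξ ≠ 0} ⟨ξ, v⟩ / F(ξ)`. -/
def polar {n : ℕ} (F : EuclideanSpace ℝ (Fin n) → ℝ) (v : EuclideanSpace ℝ (Fin n)) : ℝ :=
  ⨆ ξ : {ξ : EuclideanSpace ℝ (Fin n) // ξ ≠ 0}, inner ℝ ξ.1 v / F ξ.1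

/-- `ν` is an outward unit normal at the boundary point `x` of the convex set `Ω`. -/
def IsOuterUnitNormal {n : ℕ} (Ω : Set (EuclideanSpace ℝ (Fin n)))
    (x ν : EuclideanSpace ℝ (Fin n)) : Prop :=
  ‖ν‖ = 1 ∧ ∀ y ∈ Ω, inner ℝ (y - x) ν ≤ 0

open Classical in
/-- The outward unit normal field of a convex set `Ω`: at a boundary point with exactly one outward
unit normal (for a bounded open convex set, almost every boundary point with respect to the surface
measure) it is this normal; at the remaining points the value is irrelevant and set to `0`. -/
def outerNormal {n : ℕ} (Ω : Set (EuclideanSpace ℝ (Fin n))) (x : EuclideanSpace ℝ (Fin n)) :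
    EuclideanSpace ℝ (Fin n) :=
  if h : ∃! ν, IsOuterUnitNormal Ω x ν then h.choose else 0

/-- The volume (Lebesgue measure) of `Ω`. -/
def vol {n : ℕ} (Ω : Set (EuclideanSpace ℝ (Fin n))) : ℝ :=
  (volume : Measure (EuclideanSpace ℝ (Fin n))).real Ω

/-- The anisotropic perimeter `P_F(Ω) = ∫_{∂Ω} F(ν) dℋⁿ⁻¹`. Here `μHE[n - 1]` is the
`(n-1)`-dimensional Hausdorff measure in its usual normalization, that is, the one that agrees with
Lebesgue measure on hyperplanes. -/
def anisotropicPerimeter {n : ℕ} (F : EuclideanSpace ℝ (Fin n) → ℝ)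
    (Ω : Set (EuclideanSpace ℝ (Fin n))) : ℝ :=
  ∫ x in frontier Ω, F (outerNormal Ω x) ∂μHE[n - 1]

/-- The anisotropic `p`-boundary momentum `M_F(Ω) = ∫_{∂Ω} F°(x)ᵖ F(ν) dℋⁿ⁻¹`. -/
def boundaryMomentum {n : ℕ} (p : ℝ) (F : EuclideanSpace ℝ (Fin n) → ℝ)
    (Ω : Set (EuclideanSpace ℝ (Fin n))) : ℝ :=
  ∫ x in frontier Ω, polar F x ^ p * F (outerNormal Ω x) ∂μHE[n - 1]

/-- The scale invariant functional `𝓕(Ω) = M_F(Ω) / (P_F(Ω) V(Ω)^{p/n})`. -/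
def functionalF {n : ℕ} (p : ℝ) (F : EuclideanSpace ℝ (Fin n) → ℝ)
    (Ω : Set (EuclideanSpace ℝ (Fin n))) : ℝ :=
  boundaryMomentum p F Ω / (anisotropicPerimeter F Ω * vol Ω ^ (p / n))

/-- `r_max^F(Ω) = max {F°(x) | x ∈ closure Ω}`. -/
def rMax {n : ℕ} (F : EuclideanSpace ℝ (Fin n) → ℝ) (Ω : Set (EuclideanSpace ℝ (Fin n))) : ℝ :=
  sSup (polar F '' closure Ω)

/-- The anisotropic `p`-excess `E_F(Ω) = r_max^F(Ω)^{p-1} - M_F(Ω) / (n V(Ω))`. -/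
def excess {n : ℕ} (p : ℝ) (F : EuclideanSpace ℝ (Fin n) → ℝ)
    (Ω : Set (EuclideanSpace ℝ (Fin n))) : ℝ :=
  rMax F Ω ^ (p - 1) - boundaryMomentum p F Ω / (n * vol Ω)

/-- The admissible sets: nonempty bounded open convex subsets of `ℝⁿ`. -/
structure IsAdmissible {n : ℕ} (Ω : Set (EuclideanSpace ℝ (Fin n))) : Prop where
  nonempty : Ω.Nonempty
  isOpen : IsOpen Ω
  isBounded : Bornology.IsBounded Ω
  convex : Convex ℝ Ω

/-- `Ω` minimizes `𝓕` among all admissible sets. -/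
def IsMinimizer {n : ℕ} (p : ℝ) (F : EuclideanSpace ℝ (Fin n) → ℝ)
    (Ω : Set (EuclideanSpace ℝ (Fin n))) : Prop :=
  IsAdmissible Ω ∧
    ∀ Ω' : Set (EuclideanSpace ℝ (Fin n)), IsAdmissible Ω' → functionalF p F Ω ≤ functionalF p F Ω'

end

/-!
Let `r = r_max` and let `x` be a point of the closure of `Ω` with `F°(x) = r`. Choose a unit vector
`ν` with `⟪x, ν⟫ = F(ν) r`. Then `Ω` lies in the Wulff shape `{F° ≤ r}`, which has the supporting
hyperplane `{⟪·, ν⟫ = F(ν) r}` at `x`. The competitor is `Ω' = Ω ∩ {⟪·, ν⟫ < c}` for a level `c`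
slightly below `F(ν) r`. As `F` is differentiable, the Wulff shape touches this hyperplane only in
`x`, so the removed cap shrinks to `x` as `c` increases to `F(ν) r`
(`IsFinslerNorm.exists_cap_subset`).

Let `θ = M / P` and let `b` be the volume of the cap. The cut replaces the boundary of the cap by a
flat face with normal `ν`, so it lowers `M - θ P = ∫ ((F°) ^ p - θ) F(ν)` by the difference of the
two integrals (`IsFinslerNorm.weightedPerimeter_inter_halfSpace`). The constant field `ζ = x / r` is
a calibration: `⟪ζ, ξ⟫ ≤ F(ξ)`, with equality for `ξ = ν`. The divergence theorem for the field
`((F°) ^ p - θ) ζ` on the cap bounds the gain from below by `b` times the growth rate of `(F°) ^ p`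
along `ζ`, and near `x` this rate is close to `p r ^ (p - 1)`. The same argument with density `1`
gives `P(Ω') ≤ P(Ω)`. Since `V ^ (p / n)` loses only the relative amount `p b / (n V)` to first
order, the functional decreases as soon as `r ^ (p - 1) > M / (n V)`, which is `E_F(Ω) > 0`
(`IsFinslerNorm.exists_functionalF_lt_of_cap`).

Only one inequality of the divergence theorem is needed, and only for fields `g ζ` of constant
direction with `g ≥ 0` growing along `ζ` (`divergence_cap_le`). It follows by comparing the integral
of `g` over the cap with the integral over the cap translated by `τ ζ`, as `τ → 0`. What leaves
through the boundary is controlled by `volume_sweep_le`: a piece `E` of `∂Ω` moving along `ζ` sweeps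
out at most the volume `∫_E |⟪ζ, ν⟫|`. Pieces with almost constant normal are nearly flat and are
handled by a linear approximation (`exists_volume_sweep_le`). The points without a unique normal
sweep out a null set, by Rademacher's theorem for the gauge of `Ω`
(`volume_sweep_diff_smoothBoundary`).

The argument needs `(F°) ^ p ≥ θ` on the cap, which holds near `x` if `θ < r ^ p`. Otherwise
`θ = r ^ p`. Then the Wulff shape `{F° < r}` has a quotient `M / P` at most `r ^ p` and at least the
volume of `Ω`, so it is a strictly better competitor unless it equals `Ω`. If `Ω` is this Wulff
shape, the density `(F°) ^ p - r ^ p` vanishes on `∂Ω`, and the gain is the integral of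
`r ^ p - (F°) ^ p` over the flat face, estimated directly in
`IsFinslerNorm.growthRate_mul_vol_le_of_wulff`.
-/

open scoped RealInnerProductSpace NNReal ENNReal Topology Pointwise

noncomputable section

variable {n : ℕ} {p : ℝ} {F : EuclideanSpace ℝ (Fin n) → ℝ} {Ω : Set (EuclideanSpace ℝ (Fin n))}

/-! ### Outer unit normals of convex sets -/

/-- The boundary points of `Ω` at which the outer unit normal is unique. -/
def smoothBoundary (Ω : Set (EuclideanSpace ℝ (Fin n))) : Set (EuclideanSpace ℝ (Fin n)) :=
  {x ∈ frontier Ω | ∃! ν, IsOuterUnitNormal Ω x ν}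

theorem outerNormal_spec {x : EuclideanSpace ℝ (Fin n)} (hx : x ∈ smoothBoundary Ω) :
    IsOuterUnitNormal Ω x (outerNormal Ω x) := by
  have h := hx.2
  rw [outerNormal, dif_pos h]
  exact h.choose_spec.1

theorem IsOuterUnitNormal.eq_outerNormal {x ν : EuclideanSpace ℝ (Fin n)}
    (h : IsOuterUnitNormal Ω x ν) (hx : x ∈ smoothBoundary Ω) : ν = outerNormal Ω x :=
  hx.2.unique h (outerNormal_spec hx)

theorem outerNormal_eq_zero {x : EuclideanSpace ℝ (Fin n)}
    (h : ¬ ∃! ν, IsOuterUnitNormal Ω x ν) : outerNormal Ω x = 0 := by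
  rw [outerNormal, dif_neg h]

theorem norm_outerNormal_le (x : EuclideanSpace ℝ (Fin n)) : ‖outerNormal Ω x‖ ≤ 1 := by
  by_cases h : ∃! ν, IsOuterUnitNormal Ω x ν
  · rw [outerNormal, dif_pos h]
    exact h.choose_spec.1.1.le
  · simp [outerNormal_eq_zero h]

theorem IsOuterUnitNormal.inner_le_of_mem_closure {x ν y : EuclideanSpace ℝ (Fin n)}
    (h : IsOuterUnitNormal Ω x ν) (hy : y ∈ closure Ω) : ⟪y - x, ν⟫ ≤ 0 := by
  have : closure Ω ⊆ {y | ⟪y - x, ν⟫ ≤ 0} :=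
    closure_minimal h.2 (isClosed_le (by fun_prop) continuous_const)
  exact this hy

theorem exists_isOuterUnitNormal (hΩ : IsAdmissible Ω) {x : EuclideanSpace ℝ (Fin n)}
    (hx : x ∈ frontier Ω) : ∃ ν, IsOuterUnitNormal Ω x ν := by
  have hx' : x ∉ Ω := by
    rw [hΩ.isOpen.frontier_eq] at hx
    exact hx.2
  obtain ⟨f, hf⟩ := geometric_hahn_banach_open_point hΩ.convex hΩ.isOpen hx'
  set v := (InnerProductSpace.toDual ℝ (EuclideanSpace ℝ (Fin n))).symm f with hv
  have hfv : ∀ y, f y = ⟪y, v⟫ := fun y => by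
    rw [real_inner_comm, hv, InnerProductSpace.toDual_symm_apply]
  have hv0 : v ≠ 0 := by
    rintro h0
    obtain ⟨y, hy⟩ := hΩ.nonempty
    have := hf y hy
    simp [hfv, h0] at this
  refine ⟨‖v‖⁻¹ • v, ?_, fun y hy => ?_⟩
  · rw [norm_smul, norm_inv, norm_norm, inv_mul_cancel₀ (norm_ne_zero_iff.2 hv0)]
  · rw [inner_smul_right, inner_sub_left, ← hfv, ← hfv]
    exact mul_nonpos_of_nonneg_of_nonpos (by positivity) (by linarith [hf y hy])

theorem IsOuterUnitNormal.inner_lt (hΩ : IsOpen Ω) {x ν y : EuclideanSpace ℝ (Fin n)}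
    (h : IsOuterUnitNormal Ω x ν) (hy : y ∈ Ω) : ⟪y - x, ν⟫ < 0 := by
  have hcont : Continuous fun t : ℝ => y + t • ν := by fun_prop
  have hev : ∀ᶠ t in 𝓝[>] (0 : ℝ), y + t • ν ∈ Ω :=
    nhdsWithin_le_nhds (hcont.continuousAt.eventually_mem
      (hΩ.mem_nhds (by simpa using hy)))
  obtain ⟨t, ht, ht0⟩ := (hev.and self_mem_nhdsWithin).exists
  have h1 := h.2 _ ht
  have h2 : ⟪y + t • ν - x, ν⟫ = ⟪y - x, ν⟫ + t := by
    rw [add_sub_right_comm, inner_add_left, inner_smul_left, real_inner_self_eq_norm_sq, h.1]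
    simp
  rw [h2] at h1
  have : (0 : ℝ) < t := ht0
  linarith

theorem IsAdmissible.isCompact_closure (hΩ : IsAdmissible Ω) : IsCompact (closure Ω) :=
  hΩ.isBounded.isCompact_closure

theorem IsAdmissible.isCompact_frontier (hΩ : IsAdmissible Ω) : IsCompact (frontier Ω) :=
  hΩ.isCompact_closure.of_isClosed_subset isClosed_frontier frontier_subset_closure

theorem isClosed_setOf_isOuterUnitNormal (Ω : Set (EuclideanSpace ℝ (Fin n))) :
    IsClosed {z : EuclideanSpace ℝ (Fin n) × EuclideanSpace ℝ (Fin n) |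
      IsOuterUnitNormal Ω z.1 z.2} := by
  have : {z : EuclideanSpace ℝ (Fin n) × EuclideanSpace ℝ (Fin n) |
      IsOuterUnitNormal Ω z.1 z.2} = {z | ‖z.2‖ = 1} ∩ ⋂ y ∈ Ω, {z | ⟪y - z.1, z.2⟫ ≤ 0} := by
    ext z
    simp [IsOuterUnitNormal]
  rw [this]
  refine (isClosed_eq (by fun_prop) continuous_const).inter
    (isClosed_biInter fun y _ => isClosed_le (by fun_prop) continuous_const)

theorem measurableSet_smoothBoundary (hΩ : IsAdmissible Ω) :
    MeasurableSet (smoothBoundary Ω) := by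
  let Q : ℕ → Set (EuclideanSpace ℝ (Fin n) × EuclideanSpace ℝ (Fin n) ×
      EuclideanSpace ℝ (Fin n)) := fun k =>
    {z | z.1 ∈ frontier Ω ∧ IsOuterUnitNormal Ω z.1 z.2.1 ∧ IsOuterUnitNormal Ω z.1 z.2.2 ∧
      1 / ((k : ℝ) + 1) ≤ ‖z.2.1 - z.2.2‖}
  have hQ : ∀ k, IsCompact (Q k) := fun k => by
    refine ((hΩ.isCompact_frontier.prod ((isCompact_closedBall (0 : EuclideanSpace ℝ (Fin n))
      1).prod (isCompact_closedBall 0 1))).of_isClosed_subset ?_ ?_)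
    · refine (isClosed_frontier.preimage continuous_fst).inter
        (((isClosed_setOf_isOuterUnitNormal Ω).preimage
          (f := fun z : EuclideanSpace ℝ (Fin n) × EuclideanSpace ℝ (Fin n) ×
            EuclideanSpace ℝ (Fin n) => (z.1, z.2.1)) (by fun_prop)).inter
        (((isClosed_setOf_isOuterUnitNormal Ω).preimage
          (f := fun z : EuclideanSpace ℝ (Fin n) × EuclideanSpace ℝ (Fin n) ×
            EuclideanSpace ℝ (Fin n) => (z.1, z.2.2)) (by fun_prop)).inter
        (isClosed_le (f := fun _ => 1 / ((k : ℝ) + 1))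
          (g := fun z : EuclideanSpace ℝ (Fin n) × EuclideanSpace ℝ (Fin n) ×
            EuclideanSpace ℝ (Fin n) => ‖z.2.1 - z.2.2‖) continuous_const (by fun_prop))))
    · rintro ⟨x, ν, ν'⟩ ⟨h1, h2, h3, -⟩
      exact ⟨h1, by simpa using h2.1.le, by simpa using h3.1.le⟩
  have key : smoothBoundary Ω = frontier Ω \ ⋃ k, Prod.fst '' Q k := by
    ext x
    constructor
    · rintro ⟨hx, hu⟩
      refine ⟨hx, fun hmem => ?_⟩
      obtain ⟨k, ⟨z, ⟨-, h2, h3, h4⟩, rfl⟩⟩ := mem_iUnion.1 hmem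
      rw [hu.unique h2 h3, sub_self, norm_zero] at h4
      have : (0 : ℝ) < 1 / ((k : ℝ) + 1) := by positivity
      linarith
    · rintro ⟨hx, hmem⟩
      obtain ⟨ν, hν⟩ := exists_isOuterUnitNormal hΩ hx
      refine ⟨hx, ν, hν, fun ν' hν' => ?_⟩
      by_contra hne
      obtain ⟨k, hk⟩ := exists_nat_one_div_lt (norm_pos_iff.2 (sub_ne_zero.2 hne))
      exact hmem (mem_iUnion.2 ⟨k, ⟨(x, ν', ν), ⟨hx, hν', hν, hk.le⟩, rfl⟩⟩)
  rw [key]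
  exact isClosed_frontier.measurableSet.diff
    (MeasurableSet.iUnion fun k => ((hQ k).image continuous_fst).measurableSet)

/-- The normal is continuous where it is unique, because the set of all pairs (point, outer unit
normal) is closed and the unit sphere is compact. -/
theorem continuousOn_outerNormal : ContinuousOn (outerNormal Ω) (smoothBoundary Ω) := by
  intro x hx
  have hcomp := isCompact_closedBall (0 : EuclideanSpace ℝ (Fin n)) 1
  have hmem : ∀ᶠ y in 𝓝[smoothBoundary Ω] x,
      outerNormal Ω y ∈ Metric.closedBall (0 : EuclideanSpace ℝ (Fin n)) 1 :=
    Filter.Eventually.of_forall fun y => mem_closedBall_zero_iff.2 (norm_outerNormal_le y)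
  have huniq : ∀ ν ∈ Metric.closedBall (0 : EuclideanSpace ℝ (Fin n)) 1,
      MapClusterPt ν (𝓝[smoothBoundary Ω] x) (outerNormal Ω) → ν = outerNormal Ω x := by
    intro ν _ hν
    obtain ⟨U, hU, hlim⟩ := mapClusterPt_iff_ultrafilter.1 hν
    have hx' : Filter.Tendsto id (U : Filter (EuclideanSpace ℝ (Fin n))) (𝓝 x) :=
      hU.trans nhdsWithin_le_nhds
    have h := (isClosed_setOf_isOuterUnitNormal Ω).mem_of_tendsto (hx'.prodMk_nhds hlim) <| by
      filter_upwards [hU self_mem_nhdsWithin] with y hy using outerNormal_spec hy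
    exact IsOuterUnitNormal.eq_outerNormal h hx
  exact hcomp.tendsto_nhds_of_unique_mapClusterPt hmem huniq

theorem measurable_indicator_outerNormal (hΩ : IsAdmissible Ω) :
    Measurable ((smoothBoundary Ω).indicator (outerNormal Ω)) := by
  classical
  rw [← piecewise_eq_indicator]
  exact continuousOn_outerNormal.measurable_piecewise continuousOn_const
    (measurableSet_smoothBoundary hΩ)

theorem indicator_outerNormal_eq {x : EuclideanSpace ℝ (Fin n)} (hx : x ∈ frontier Ω) :
    (smoothBoundary Ω).indicator (outerNormal Ω) x = outerNormal Ω x := by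
  by_cases h : x ∈ smoothBoundary Ω
  · exact indicator_of_mem h _
  · rw [indicator_of_notMem h, outerNormal_eq_zero fun h' => h ⟨hx, h'⟩]

/-- On a set of smooth boundary points whose normals are `δ`-close to `ν`, the coordinate in
direction `ν` is `δ`-Lipschitz. -/
theorem abs_inner_sub_le {x y ν ν₁ ν₂ : EuclideanSpace ℝ (Fin n)} {δ : ℝ}
    (hx : x ∈ frontier Ω) (hy : y ∈ frontier Ω) (hν₁ : IsOuterUnitNormal Ω x ν₁)
    (hν₂ : IsOuterUnitNormal Ω y ν₂) (h₁ : ‖ν₁ - ν‖ ≤ δ) (h₂ : ‖ν₂ - ν‖ ≤ δ) :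
    |⟪x - y, ν⟫| ≤ δ * ‖x - y‖ := by
  have a1 := hν₁.inner_le_of_mem_closure (frontier_subset_closure hy)
  have a2 := hν₂.inner_le_of_mem_closure (frontier_subset_closure hx)
  have b1 := (abs_le.1 (abs_real_inner_le_norm (x - y) (ν₁ - ν))).2
  have b2 := (abs_le.1 (abs_real_inner_le_norm (x - y) (ν₂ - ν))).1
  rw [inner_sub_right] at b1 b2
  have c1 := mul_le_mul_of_nonneg_left h₁ (norm_nonneg (x - y))
  have c2 := mul_le_mul_of_nonneg_left h₂ (norm_nonneg (x - y))
  have d1 : ⟪y - x, ν₁⟫ = -⟪x - y, ν₁⟫ := by rw [← inner_neg_left, neg_sub]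
  rw [abs_le]
  constructor <;> nlinarith

/-! ### Volume of sets swept out by pieces of a hyperplane -/

theorem volume_eq_lintegral_slice {ν : EuclideanSpace ℝ (Fin n)} (hν : ‖ν‖ = 1)
    {Z : Set (EuclideanSpace ℝ (Fin n))} (hZ : MeasurableSet Z) :
    volume Z = ∫⁻ s : ℝ, μHE[n - 1] (Z ∩ {z | ⟪z, ν⟫ = s}) := by
  have hν0 : ν ≠ 0 := by
    rintro rfl
    simp at hν
  have h := EuclideanGeometry.euclideanHausdorffMeasure_eq_lintegral
    (0 : EuclideanSpace ℝ (Fin n)) hν0 hZ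
  rw [InnerProductSpace.euclideanHausdorffMeasure_eq_volume, finrank_euclideanSpace_fin] at h
  rw [h]
  have h1 : ‖ν‖ₑ = 1 := by rw [← ofReal_norm, hν, ENNReal.ofReal_one]
  rw [h1, one_mul]
  refine lintegral_congr fun s => ?_
  congr 2
  ext z
  simp only [SetLike.mem_coe, AffineSubspace.mem_mk',
    Submodule.mem_orthogonal_singleton_iff_inner_right, mem_ofPred_eq,
    vadd_eq_add, add_zero, vsub_eq_sub, inner_sub_right, inner_smul_right,
    real_inner_self_eq_norm_sq, hν, real_inner_comm]
  constructor <;> intro h <;> linarith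

theorem lintegral_comp_sub_div (f : ℝ → ℝ≥0∞) (c : ℝ) {a : ℝ} (ha : 0 < a) :
    ∫⁻ s : ℝ, f ((s - c) / a) = ENNReal.ofReal a * ∫⁻ t : ℝ, f t := by
  rw [lintegral_sub_right_eq_self (fun s => f (s / a)) c]
  have h := (measurableEmbedding_mulLeft₀ ha.ne').lintegral_map (μ := volume) fun s => f (s / a)
  rw [Real.map_volume_mul_left ha.ne', lintegral_smul_measure, abs_of_pos (inv_pos.2 ha)] at h
  simp only [mul_div_cancel_left₀ _ ha.ne'] at h
  rw [← h, smul_eq_mul, ← mul_assoc, ← ENNReal.ofReal_mul ha.le, mul_inv_cancel₀ ha.ne',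
    ENNReal.ofReal_one, one_mul]

/-- The region swept out by a piece `T` of a hyperplane when each `y ∈ T` moves by up to `k y` in
the direction `ζ` has volume `⟪ζ, ν⟫ ∫_T k`. -/
theorem volume_subgraph {ν ζ : EuclideanSpace ℝ (Fin n)} (hν : ‖ν‖ = 1) (hζ : 0 < ⟪ζ, ν⟫)
    {T : Set (EuclideanSpace ℝ (Fin n))} (hT : MeasurableSet T) {c : ℝ}
    (hTc : ∀ y ∈ T, ⟪y, ν⟫ = c) {k : EuclideanSpace ℝ (Fin n) → ℝ} (hk : Measurable k)
    (hk0 : ∀ y ∈ T, 0 ≤ k y) :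
    volume {z | ∃ y ∈ T, ∃ t, 0 < t ∧ t ≤ k y ∧ z = y + t • ζ} =
      ENNReal.ofReal ⟪ζ, ν⟫ * ∫⁻ y in T, ENNReal.ofReal (k y) ∂μHE[n - 1] := by
  set a := ⟪ζ, ν⟫ with ha
  have hproj : ∀ y ∈ T, ∀ t : ℝ, (⟪y + t • ζ, ν⟫ - c) / a = t := fun y hy t => by
    rw [inner_add_left, inner_smul_left, hTc y hy, ← ha]
    simp [hζ.ne']
  have hZ : MeasurableSet {z | ∃ y ∈ T, ∃ t, 0 < t ∧ t ≤ k y ∧ z = y + t • ζ} := by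
    have hm : Measurable fun z : EuclideanSpace ℝ (Fin n) => z - ((⟪z, ν⟫ - c) / a) • ζ := by
      fun_prop
    have hm' : Measurable fun z : EuclideanSpace ℝ (Fin n) => (⟪z, ν⟫ - c) / a := by fun_prop
    have : {z | ∃ y ∈ T, ∃ t, 0 < t ∧ t ≤ k y ∧ z = y + t • ζ} =
        {z | z - ((⟪z, ν⟫ - c) / a) • ζ ∈ T} ∩ ({z | 0 < (⟪z, ν⟫ - c) / a} ∩
          {z | (⟪z, ν⟫ - c) / a ≤ k (z - ((⟪z, ν⟫ - c) / a) • ζ)}) := by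
      ext z
      constructor
      · rintro ⟨y, hy, t, ht0, htk, rfl⟩
        simp only [mem_inter_iff, mem_ofPred_eq, hproj y hy t, add_sub_cancel_right]
        exact ⟨hy, ht0, htk⟩
      · rintro ⟨h1, h2, h3⟩
        exact ⟨_, h1, _, h2, h3, by simp⟩
    rw [this]
    exact (hm hT).inter ((measurableSet_lt measurable_const hm').inter
      (measurableSet_le hm' (hk.comp hm)))
  -- the slices of the region are translates of the superlevel sets of `k`
  rw [volume_eq_lintegral_slice hν hZ, lintegral_eq_lintegral_meas_le _
    (ae_restrict_of_forall_mem hT hk0) hk.aemeasurable]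
  rw [← lintegral_indicator measurableSet_Ioi, ← lintegral_comp_sub_div _ c hζ]
  refine lintegral_congr fun s => ?_
  by_cases hs : 0 < (s - c) / a
  · rw [indicator_of_mem (by exact hs),
      Measure.restrict_apply (measurableSet_le measurable_const hk)]
    have hiso : Isometry fun y : EuclideanSpace ℝ (Fin n) => y + ((s - c) / a) • ζ :=
      isometry_add_right _
    rw [← hiso.euclideanHausdorffMeasure_image ({y | (s - c) / a ≤ k y} ∩ T)]
    congr 1
    ext z
    constructor
    · rintro ⟨⟨y, hy, t, ht0, htk, rfl⟩, hz⟩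
      have : (s - c) / a = t := by rw [← hproj y hy t, ← show _ = s from hz]
      exact ⟨y, ⟨by rw [this]; exact htk, hy⟩, by simp only [this]⟩
    · rintro ⟨y, ⟨hyk, hy⟩, rfl⟩
      refine ⟨⟨y, hy, _, hs, hyk, rfl⟩, ?_⟩
      have := hproj y hy ((s - c) / a)
      rw [div_left_inj' hζ.ne'] at this
      simp only [mem_ofPred_eq]
      linarith
  · rw [indicator_of_notMem (by exact hs)]
    convert measure_empty (μ := μHE[n - 1])
    rw [eq_empty_iff_forall_notMem]
    rintro _ ⟨⟨y, hy, t, ht0, htk, rfl⟩, hz⟩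
    apply hs
    rw [← show _ = s from hz, hproj y hy t]
    exact ht0

theorem volume_cylinder {ν ζ : EuclideanSpace ℝ (Fin n)} (hν : ‖ν‖ = 1) (hζ : 0 < ⟪ζ, ν⟫)
    {T : Set (EuclideanSpace ℝ (Fin n))} (hT : MeasurableSet T) {c : ℝ}
    (hTc : ∀ y ∈ T, ⟪y, ν⟫ = c) {τ : ℝ} (hτ : 0 ≤ τ) :
    volume {z | ∃ y ∈ T, ∃ t, 0 < t ∧ t ≤ τ ∧ z = y + t • ζ} =
      ENNReal.ofReal ⟪ζ, ν⟫ * (ENNReal.ofReal τ * μHE[n - 1] T) := by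
  rw [volume_subgraph hν hζ hT hTc measurable_const fun _ _ => hτ, setLIntegral_const]

/-! ### Finiteness of the surface measure -/

theorem LipschitzOnWith.euclideanHausdorffMeasure_image_le {X Y : Type*} [EMetricSpace X]
    [MeasurableSpace X] [BorelSpace X] [EMetricSpace Y] [MeasurableSpace Y] [BorelSpace Y]
    {K : ℝ≥0} {f : X → Y} {s : Set X} (h : LipschitzOnWith K f s) (d : ℕ) :
    μHE[d] (f '' s) ≤ (K : ℝ≥0∞) ^ d * μHE[d] s := by
  have := h.hausdorffMeasure_image_le (d := d) (by positivity)
  rw [Measure.euclideanHausdorffMeasure_def, Measure.euclideanHausdorffMeasure_def,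
    Measure.smul_apply, Measure.smul_apply, ENNReal.smul_def, ENNReal.smul_def, smul_eq_mul,
    smul_eq_mul, mul_left_comm]
  rw [ENNReal.rpow_natCast] at this
  gcongr

/-- Orthogonal projection onto the hyperplane `νᗮ`, for a unit vector `ν`. -/
def hyperplaneProj (ν x : EuclideanSpace ℝ (Fin n)) : EuclideanSpace ℝ (Fin n) :=
  x - ⟪x, ν⟫ • ν

theorem inner_hyperplaneProj {ν : EuclideanSpace ℝ (Fin n)} (hν : ‖ν‖ = 1)
    (x : EuclideanSpace ℝ (Fin n)) : ⟪hyperplaneProj ν x, ν⟫ = 0 := by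
  rw [hyperplaneProj, inner_sub_left, inner_smul_left, real_inner_self_eq_norm_sq, hν]
  simp

theorem hyperplaneProj_sub (ν x y : EuclideanSpace ℝ (Fin n)) :
    hyperplaneProj ν x - hyperplaneProj ν y = hyperplaneProj ν (x - y) := by
  simp only [hyperplaneProj, inner_sub_left, sub_smul]
  abel

theorem norm_hyperplaneProj_le {ν : EuclideanSpace ℝ (Fin n)} (hν : ‖ν‖ = 1)
    (x : EuclideanSpace ℝ (Fin n)) : ‖hyperplaneProj ν x‖ ≤ ‖x‖ := by
  refine le_of_sq_le_sq ?_ (norm_nonneg x)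
  have : ‖hyperplaneProj ν x‖ ^ 2 = ‖x‖ ^ 2 - ⟪x, ν⟫ ^ 2 := by
    rw [hyperplaneProj, norm_sub_sq_real, inner_smul_right, norm_smul, hν]
    simp only [Real.norm_eq_abs, mul_one, sq_abs]
    ring
  nlinarith [sq_nonneg ⟪x, ν⟫]

theorem norm_sub_le_two_mul {ν x y : EuclideanSpace ℝ (Fin n)} {δ : ℝ} (hν : ‖ν‖ = 1)
    (hδ : δ ≤ 1 / 2) (h : |⟪x - y, ν⟫| ≤ δ * ‖x - y‖) :
    ‖x - y‖ ≤ 2 * ‖hyperplaneProj ν x - hyperplaneProj ν y‖ := by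
  have h1 : x - y = hyperplaneProj ν (x - y) + ⟪x - y, ν⟫ • ν := by simp [hyperplaneProj]
  have h2 := norm_add_le (hyperplaneProj ν (x - y)) (⟪x - y, ν⟫ • ν)
  rw [← h1, norm_smul, hν, Real.norm_eq_abs, mul_one] at h2
  rw [hyperplaneProj_sub]
  nlinarith [norm_nonneg (x - y)]

theorem lipschitzWith_hyperplaneProj {ν : EuclideanSpace ℝ (Fin n)} (hν : ‖ν‖ = 1) :
    LipschitzWith 1 (hyperplaneProj ν) :=
  LipschitzWith.of_dist_le_mul fun x y => by
    rw [dist_eq_norm, dist_eq_norm, hyperplaneProj_sub]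
    simpa using norm_hyperplaneProj_le hν (x - y)

theorem volume_thickening_le {ν : EuclideanSpace ℝ (Fin n)} (hν : ‖ν‖ = 1)
    {B : Set (EuclideanSpace ℝ (Fin n))} (hB : ∀ y ∈ B, ⟪y, ν⟫ = 0) :
    volume {z | ∃ y ∈ B, ∃ t : ℝ, 0 < t ∧ t ≤ 1 ∧ z = y + t • ν} ≤ μHE[n - 1] B := by
  have hνν : ⟪ν, ν⟫ = (1 : ℝ) := by rw [real_inner_self_eq_norm_sq, hν, one_pow]
  have hm : MeasurableSet (toMeasurable μHE[n - 1] B ∩ {y | ⟪y, ν⟫ = 0}) :=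
    (measurableSet_toMeasurable _ _).inter (measurableSet_eq_fun (by fun_prop) (by fun_prop))
  have h := volume_cylinder hν (ζ := ν) (by rw [hνν]; exact one_pos) hm
    (fun y hy => hy.2) zero_le_one
  calc volume {z | ∃ y ∈ B, ∃ t : ℝ, 0 < t ∧ t ≤ 1 ∧ z = y + t • ν}
      ≤ volume {z | ∃ y ∈ toMeasurable μHE[n - 1] B ∩ {y | ⟪y, ν⟫ = 0},
          ∃ t : ℝ, 0 < t ∧ t ≤ 1 ∧ z = y + t • ν} := by
        refine measure_mono ?_
        rintro z ⟨y, hy, h⟩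
        exact ⟨y, ⟨subset_toMeasurable _ _ hy, hB y hy⟩, h⟩
    _ ≤ μHE[n - 1] B := by
        rw [h, hνν, ENNReal.ofReal_one, one_mul, one_mul, ← measure_toMeasurable B]
        exact measure_mono inter_subset_left

theorem euclideanHausdorffMeasure_lt_top_of_subset_hyperplane {ν : EuclideanSpace ℝ (Fin n)}
    (hν : ‖ν‖ = 1) {c : ℝ} {B : Set (EuclideanSpace ℝ (Fin n))} (hBc : ∀ y ∈ B, ⟪y, ν⟫ = c)
    (hB : Bornology.IsBounded B) : μHE[n - 1] B < ⊤ := by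
  have hνν : ⟪ν, ν⟫ = (1 : ℝ) := by rw [real_inner_self_eq_norm_sq, hν, one_pow]
  obtain ⟨R, hR⟩ := hB.subset_closedBall 0
  have hm : MeasurableSet (Metric.closedBall 0 R ∩ {y : EuclideanSpace ℝ (Fin n) | ⟪y, ν⟫ = c}) :=
    measurableSet_closedBall.inter (measurableSet_eq_fun (by fun_prop) (by fun_prop))
  have h := volume_cylinder hν (ζ := ν) (by rw [hνν]; exact one_pos) hm
    (fun y hy => hy.2) zero_le_one
  rw [hνν, ENNReal.ofReal_one, one_mul, one_mul] at h
  have hsub : B ⊆ Metric.closedBall 0 R ∩ {y : EuclideanSpace ℝ (Fin n) | ⟪y, ν⟫ = c} :=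
    fun y hy => ⟨hR hy, hBc y hy⟩
  refine (measure_mono hsub).trans_lt ?_
  rw [← h]
  refine lt_of_le_of_lt (measure_mono ?_) (measure_closedBall_lt_top (x := 0) (r := R + 1))
  rintro _ ⟨y, ⟨hy, -⟩, t, ht0, ht1, rfl⟩
  rw [mem_closedBall_zero_iff] at hy ⊢
  refine (norm_add_le _ _).trans (add_le_add hy ?_)
  rw [norm_smul, hν, mul_one, Real.norm_eq_abs, abs_of_pos ht0]
  exact ht1

theorem measure_lt_top_of_abs_inner_sub_le {ν : EuclideanSpace ℝ (Fin n)} (hν : ‖ν‖ = 1)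
    {E : Set (EuclideanSpace ℝ (Fin n))} (hE : Bornology.IsBounded E)
    (h : ∀ x ∈ E, ∀ y ∈ E, |⟪x - y, ν⟫| ≤ 1 / 2 * ‖x - y‖) : μHE[n - 1] E < ⊤ := by
  have hinj : InjOn (hyperplaneProj ν) E := fun x hx y hy hxy => by
    have := norm_sub_le_two_mul hν le_rfl (h x hx y hy)
    rw [hxy, sub_self, norm_zero, mul_zero] at this
    exact sub_eq_zero.1 (norm_le_zero_iff.1 this)
  have hlip : LipschitzOnWith 2 (Function.invFunOn (hyperplaneProj ν) E)
      (hyperplaneProj ν '' E) := by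
    refine LipschitzOnWith.of_dist_le_mul ?_
    rintro _ ⟨x, hx, rfl⟩ _ ⟨y, hy, rfl⟩
    rw [hinj.leftInvOn_invFunOn hx, hinj.leftInvOn_invFunOn hy, dist_eq_norm, dist_eq_norm]
    exact norm_sub_le_two_mul hν le_rfl (h x hx y hy)
  have himage : Function.invFunOn (hyperplaneProj ν) E '' (hyperplaneProj ν '' E) = E :=
    hinj.invFunOn_image Subset.rfl
  have := hlip.euclideanHausdorffMeasure_image_le (n - 1)
  rw [himage] at this
  refine this.trans_lt (ENNReal.mul_lt_top (by simp) ?_)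
  refine euclideanHausdorffMeasure_lt_top_of_subset_hyperplane hν (c := 0) ?_
    ((lipschitzWith_hyperplaneProj hν).isBounded_image hE)
  rintro _ ⟨x, -, rfl⟩
  exact inner_hyperplaneProj hν x

/-- The boundary of a bounded convex set has finite surface measure: finitely many pieces, on each
of which some choice of normals stays close to a fixed unit vector, are Lipschitz graphs over
bounded subsets of hyperplanes. -/
theorem IsAdmissible.measure_frontier_lt_top (hΩ : IsAdmissible Ω) :
    μHE[n - 1] (frontier Ω) < ⊤ := by
  obtain ⟨N, hNs, hNf, hN⟩ := (isCompact_sphere (0 : EuclideanSpace ℝ (Fin n)) 1).finite_cover_balls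
    (e := 1 / 2) (by norm_num)
  have hcover : frontier Ω ⊆ ⋃ ν ∈ N,
      {x ∈ frontier Ω | ∃ ν', IsOuterUnitNormal Ω x ν' ∧ ‖ν' - ν‖ ≤ 1 / 2} := by
    intro x hx
    obtain ⟨ν', hν'⟩ := exists_isOuterUnitNormal hΩ hx
    obtain ⟨ν, hν, hball⟩ := mem_iUnion₂.1 (hN (mem_sphere_zero_iff_norm.2 hν'.1))
    exact mem_iUnion₂.2 ⟨ν, hν, hx, ν', hν', by rw [← dist_eq_norm]; exact hball.le⟩
  refine (measure_mono hcover).trans_lt (measure_biUnion_lt_top hNf fun ν hν => ?_)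
  refine measure_lt_top_of_abs_inner_sub_le (mem_sphere_zero_iff_norm.1 (hNs hν))
    (hΩ.isCompact_frontier.isBounded.subset fun x hx => hx.1) ?_
  rintro x ⟨hx, ν₁, h₁, h₁'⟩ y ⟨hy, ν₂, h₂, h₂'⟩
  exact abs_inner_sub_le hx hy h₁ h₂ h₁' h₂'

/-! ### Volume swept out by pieces of the boundary -/

/-- The region swept out by the set `E` moving along the vector `-ζ`. -/
def sweep (ζ : EuclideanSpace ℝ (Fin n)) (E : Set (EuclideanSpace ℝ (Fin n))) :
    Set (EuclideanSpace ℝ (Fin n)) :=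
  {z | ∃ x ∈ E, ∃ t : ℝ, 0 < t ∧ t ≤ 1 ∧ z = x - t • ζ}

theorem sweep_mono {ζ : EuclideanSpace ℝ (Fin n)} {E E' : Set (EuclideanSpace ℝ (Fin n))}
    (h : E ⊆ E') : sweep ζ E ⊆ sweep ζ E' := by
  rintro z ⟨x, hx, hz⟩
  exact ⟨x, h hx, hz⟩

theorem sweep_iUnion {ι : Type*} (ζ : EuclideanSpace ℝ (Fin n))
    (E : ι → Set (EuclideanSpace ℝ (Fin n))) : sweep ζ (⋃ i, E i) = ⋃ i, sweep ζ (E i) := by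
  ext z
  simp only [sweep, mem_iUnion, mem_ofPred_eq]
  constructor
  · rintro ⟨x, ⟨i, hi⟩, h⟩
    exact ⟨i, x, hi, h⟩
  · rintro ⟨i, x, hi, h⟩
    exact ⟨x, ⟨i, hi⟩, h⟩

theorem sweep_union (ζ : EuclideanSpace ℝ (Fin n)) (E E' : Set (EuclideanSpace ℝ (Fin n))) :
    sweep ζ (E ∪ E') = sweep ζ E ∪ sweep ζ E' := by
  rw [union_eq_iUnion, sweep_iUnion, union_eq_iUnion]
  congr 1
  ext b
  cases b <;> rfl

/-- A piece of a surface that is almost orthogonal to `ν` sweeps out in direction `ζ` at most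
about `|⟪ζ, ν⟫|` times its area: it is, up to a small Lipschitz perturbation, the image of its
orthogonal thickening over `νᗮ` under a linear map of determinant `-⟪ζ, ν⟫`. -/
theorem exists_volume_sweep_le {ν : EuclideanSpace ℝ (Fin n)} (hν : ‖ν‖ = 1)
    (ζ : EuclideanSpace ℝ (Fin n)) {m : ℝ≥0} (hm : ENNReal.ofReal |⟪ζ, ν⟫| < m) :
    ∃ δ : ℝ, 0 < δ ∧ ∀ E : Set (EuclideanSpace ℝ (Fin n)),
      (∀ x ∈ E, ∀ y ∈ E, |⟪x - y, ν⟫| ≤ δ * ‖x - y‖) →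
        volume (sweep ζ E) ≤ m * μHE[n - 1] E := by
  have hνν : ⟪ν, ν⟫ = (1 : ℝ) := by rw [real_inner_self_eq_norm_sq, hν, one_pow]
  let A : EuclideanSpace ℝ (Fin n) →L[ℝ] EuclideanSpace ℝ (Fin n) :=
    LinearMap.toContinuousLinearMap
      (LinearMap.transvection (innerₛₗ ℝ ν) (-(ν + ζ)))
  have hA : ∀ v, A v = v - ⟪v, ν⟫ • (ν + ζ) := fun v => by
    simp [A, LinearMap.transvection.apply, real_inner_comm, sub_eq_add_neg]
  have hdet : |A.det| = |⟪ζ, ν⟫| := by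
    have : A.det = 1 + innerₛₗ ℝ ν (-(ν + ζ)) := by
      rw [← LinearMap.transvection.det]
      rfl
    rw [this]
    simp only [innerₛₗ_apply_apply, inner_neg_right, inner_add_right, hνν, real_inner_comm]
    rw [← abs_neg]
    congr 1
    ring
  have hev := addHaar_image_le_mul_of_det_lt volume A (m := m) (by rwa [hdet])
  obtain ⟨δ, hδ, hδ0, hδ1⟩ := (hev.and (Ioo_mem_nhdsGT (show (0 : ℝ≥0) < 1 by norm_num))).exists
  have hδ0' : (0 : ℝ) < δ := by exact_mod_cast hδ0
  have hδ1' : (δ : ℝ) < 1 := by exact_mod_cast hδ1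
  refine ⟨δ / 2, by positivity, fun E hE => ?_⟩
  have hE2 : ∀ x ∈ E, ∀ y ∈ E,
      ‖x - y‖ ≤ 2 * ‖hyperplaneProj ν x - hyperplaneProj ν y‖ := fun x hx y hy =>
    norm_sub_le_two_mul hν (by linarith) (hE x hx y hy)
  have hinj : InjOn (hyperplaneProj ν) E := fun x hx y hy hxy => by
    have := hE2 x hx y hy
    rw [hxy, sub_self, norm_zero, mul_zero] at this
    exact sub_eq_zero.1 (norm_le_zero_iff.1 this)
  let s : Set (EuclideanSpace ℝ (Fin n)) :=
    {z | ∃ y ∈ hyperplaneProj ν '' E, ∃ t : ℝ, 0 < t ∧ t ≤ 1 ∧ z = y + t • ν}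
  let f : EuclideanSpace ℝ (Fin n) → EuclideanSpace ℝ (Fin n) := fun z =>
    Function.invFunOn (hyperplaneProj ν) E (hyperplaneProj ν z) - ⟪z, ν⟫ • ζ
  have hP : ∀ x (t : ℝ), hyperplaneProj ν (hyperplaneProj ν x + t • ν) = hyperplaneProj ν x := by
    intro x t
    have : ⟪hyperplaneProj ν x + t • ν, ν⟫ = t := by
      rw [inner_add_left, inner_hyperplaneProj hν, inner_smul_left, hνν]
      simp
    rw [hyperplaneProj, this, add_sub_cancel_right]
  have hI : ∀ x (t : ℝ), ⟪hyperplaneProj ν x + t • ν, ν⟫ = t := by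
    intro x t
    rw [inner_add_left, inner_hyperplaneProj hν, inner_smul_left, hνν]
    simp
  have hf : ∀ x ∈ E, ∀ t : ℝ, f (hyperplaneProj ν x + t • ν) = x - t • ζ := fun x hx t => by
    simp only [f]
    rw [hP, hI, hinj.leftInvOn_invFunOn hx]
  have happrox : ApproximatesLinearOn f A s δ := by
    rintro _ ⟨_, ⟨x, hx, rfl⟩, t, -, -, rfl⟩ _ ⟨_, ⟨y, hy, rfl⟩, t', -, -, rfl⟩
    rw [hf x hx, hf y hy, hA, inner_sub_left, hI, hI]
    have h1 : x - t • ζ - (y - t' • ζ) - (hyperplaneProj ν x + t • ν - (hyperplaneProj ν y + t' • ν)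
        - (t - t') • (ν + ζ)) = ⟪x - y, ν⟫ • ν := by
      simp only [hyperplaneProj, inner_sub_left, sub_smul, smul_add]
      abel
    have h2 : ‖hyperplaneProj ν x - hyperplaneProj ν y‖ ≤
        ‖hyperplaneProj ν x + t • ν - (hyperplaneProj ν y + t' • ν)‖ := by
      have := norm_hyperplaneProj_le hν
        (hyperplaneProj ν x + t • ν - (hyperplaneProj ν y + t' • ν))
      rwa [← hyperplaneProj_sub, hP, hP] at this
    rw [h1, norm_smul, hν, mul_one, Real.norm_eq_abs]
    have h3 := hE x hx y hy
    have h4 := hE2 x hx y hy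
    nlinarith
  have himage : sweep ζ E ⊆ f '' s := by
    rintro z ⟨x, hx, t, ht0, ht1, rfl⟩
    exact ⟨_, ⟨_, mem_image_of_mem _ hx, t, ht0, ht1, rfl⟩, hf x hx t⟩
  have hs : volume s ≤ μHE[n - 1] E := by
    refine (volume_thickening_le hν ?_).trans ?_
    · rintro _ ⟨x, -, rfl⟩
      exact inner_hyperplaneProj hν x
    · simpa using ((lipschitzWith_hyperplaneProj hν).lipschitzOnWith
        (s := E)).euclideanHausdorffMeasure_image_le (n - 1)
  calc volume (sweep ζ E) ≤ volume (f '' s) := measure_mono himage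
    _ ≤ m * volume s := hδ s f happrox
    _ ≤ m * μHE[n - 1] E := by gcongr

/-- Where the gauge of `Ω` (centred at `q ∈ Ω`) is differentiable, the boundary point on the same
ray has only one outer unit normal, a multiple of the gradient of the gauge. -/
theorem mem_smoothBoundary_of_differentiableAt_gauge (hΩ : IsAdmissible Ω)
    {q x : EuclideanSpace ℝ (Fin n)} (hq : q ∈ Ω) (hx : x ∈ frontier Ω) {s : ℝ} (hs : 0 < s)
    (hd : DifferentiableAt ℝ (gauge ((fun y => y + q) ⁻¹' Ω)) (s • (x - q))) :
    x ∈ smoothBoundary Ω := by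
  set j := gauge ((fun y => y + q) ⁻¹' Ω) with hj
  have hconv : Convex ℝ ((fun y => y + q) ⁻¹' Ω) := hΩ.convex.translate_preimage_left q
  have hopen : IsOpen ((fun y => y + q) ⁻¹' Ω) := hΩ.isOpen.preimage (by fun_prop)
  have h0 : (0 : EuclideanSpace ℝ (Fin n)) ∈ (fun y => y + q) ⁻¹' Ω := by simpa using hq
  have hjx : j (x - q) = 1 := by
    rw [hj, gauge_eq_one_iff_mem_frontier hconv (hopen.mem_nhds h0)]
    have := (Homeomorph.addRight q).preimage_frontier Ω
    rw [show (fun y => y + q) = ⇑(Homeomorph.addRight q) from rfl, ← this]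
    simpa using hx
  have key : ∀ ν, IsOuterUnitNormal Ω x ν → ∀ v,
      ⟪v, ν⟫ = ⟪x - q, ν⟫ * fderiv ℝ j (s • (x - q)) v := by
    intro ν hν v
    have hh : 0 < ⟪x - q, ν⟫ := by
      have := hν.inner_lt hΩ.isOpen hq
      rw [← neg_sub, inner_neg_left] at this
      linarith
    have hle : ∀ w, ⟪w, ν⟫ ≤ ⟪x - q, ν⟫ * j w := by
      intro w
      refine le_of_forall_gt_imp_ge_of_dense fun b hb => ?_
      rw [mul_comm, ← lt_div_iff₀ hh] at hb
      obtain ⟨b', hb', hb'0, hwb⟩ := exists_lt_of_gauge_lt (absorbent_nhds_zero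
        (hopen.mem_nhds h0)) hb
      obtain ⟨y, hy, rfl⟩ := hwb
      have h1 := hν.2 _ hy
      have h2 : ⟪y, ν⟫ ≤ ⟪x - q, ν⟫ := by
        have : y + q - x = y - (x - q) := by abel
        simp only at h1
        rw [this, inner_sub_left] at h1
        linarith
      simp only [inner_smul_left, conj_trivial]
      rw [lt_div_iff₀ hh] at hb'0
      nlinarith
    have hmin : IsLocalMin (fun w => ⟪x - q, ν⟫ * j w - ⟪w, ν⟫) (s • (x - q)) := by
      refine Filter.Eventually.of_forall fun w => ?_
      have h1 : j (s • (x - q)) = s := by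
        rw [hj, gauge_smul_of_nonneg hs.le, ← hj, hjx, smul_eq_mul, mul_one]
      simp only [h1, inner_smul_left, conj_trivial]
      linarith [hle w, mul_comm s ⟪x - q, ν⟫]
    have hder : HasFDerivAt (fun w => ⟪x - q, ν⟫ * j w - ⟪w, ν⟫)
        (⟪x - q, ν⟫ • fderiv ℝ j (s • (x - q)) - innerSL ℝ ν) (s • (x - q)) := by
      refine (hd.hasFDerivAt.const_mul _).sub ?_
      have := (innerSL ℝ ν).hasFDerivAt (x := s • (x - q))
      simpa [real_inner_comm] using this
    have := congrArg (fun L => L v) (hmin.hasFDerivAt_eq_zero hder)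
    simp only [sub_apply, smul_apply, smul_eq_mul,
      innerSL_apply_apply, zero_apply] at this
    rw [real_inner_comm]
    linarith
  obtain ⟨ν, hν⟩ := exists_isOuterUnitNormal hΩ hx
  refine ⟨hx, ν, hν, fun ν' hν' => ?_⟩
  have hpos : ∀ μ, IsOuterUnitNormal Ω x μ → 0 < ⟪x - q, μ⟫ := fun μ hμ => by
    have := hμ.inner_lt hΩ.isOpen hq
    rw [← neg_sub, inner_neg_left] at this
    linarith
  have hsmul : ⟪x - q, ν⟫ • ν' = ⟪x - q, ν'⟫ • ν := by
    refine ext_inner_left ℝ fun v => ?_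
    rw [inner_smul_right, inner_smul_right, key ν hν v, key ν' hν' v]
    ring
  have hnorm := congrArg norm hsmul
  rw [norm_smul, norm_smul, hν.1, hν'.1, mul_one, mul_one, Real.norm_eq_abs, Real.norm_eq_abs,
    abs_of_pos (hpos ν hν), abs_of_pos (hpos ν' hν')] at hnorm
  rw [hnorm] at hsmul
  exact smul_right_injective _ (hpos ν' hν').ne' hsmul

/-- Boundary points with several normals sweep out a null set. By Rademacher's theorem for the
gauge they lie on a null set of rays through a centre `q`, and a Lipschitz map carries these
rays to segments parallel to `ζ`. -/
theorem volume_sweep_diff_smoothBoundary (hΩ : IsAdmissible Ω)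
    (ζ : EuclideanSpace ℝ (Fin n)) : volume (sweep ζ (frontier Ω \ smoothBoundary Ω)) = 0 := by
  obtain ⟨q, hq⟩ := hΩ.nonempty
  set j := gauge ((fun y => y + q) ⁻¹' Ω) with hj
  have hconv : Convex ℝ ((fun y => y + q) ⁻¹' Ω) := hΩ.convex.translate_preimage_left q
  have hopen : IsOpen ((fun y => y + q) ⁻¹' Ω) := hΩ.isOpen.preimage (by fun_prop)
  have h0 : (0 : EuclideanSpace ℝ (Fin n)) ∈ (fun y => y + q) ⁻¹' Ω := by simpa using hq
  have hjx : ∀ x ∈ frontier Ω, j (x - q) = 1 := fun x hx => by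
    rw [hj, gauge_eq_one_iff_mem_frontier hconv (hopen.mem_nhds h0)]
    have := (Homeomorph.addRight q).preimage_frontier Ω
    rw [show (fun y => y + q) = ⇑(Homeomorph.addRight q) from rfl, ← this]
    simpa using hx
  obtain ⟨K, hK⟩ := hconv.lipschitz_gauge (hopen.mem_nhds h0)
  rw [← hj] at hK
  obtain ⟨R, hR0, hR⟩ := hΩ.isCompact_frontier.isBounded.subset_closedBall_lt 0 q
  have hRx : ∀ x ∈ frontier Ω, ‖x - q‖ ≤ R := fun x hx => by
    rw [← dist_eq_norm]
    exact hR hx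
  let B : Set (EuclideanSpace ℝ (Fin n)) :=
    {w | ∃ x ∈ frontier Ω \ smoothBoundary Ω, ∃ s : ℝ, 1 / 2 ≤ s ∧ s ≤ 1 ∧ w = s • (x - q)}
  have hB : volume B = 0 := by
    refine measure_mono_null ?_ (ae_iff.1 hK.ae_differentiableAt)
    rintro w ⟨x, ⟨hx, hxs⟩, s, hs, -, rfl⟩ hd
    exact hxs (mem_smoothBoundary_of_differentiableAt_gauge hΩ hq hx (by linarith) hd)
  let Ψ : EuclideanSpace ℝ (Fin n) → EuclideanSpace ℝ (Fin n) := fun w =>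
    q + (j w)⁻¹ • w - (2 * (1 - j w)) • ζ
  have hjB : ∀ x ∈ frontier Ω, ∀ s : ℝ, 0 ≤ s → j (s • (x - q)) = s := fun x hx s hs => by
    rw [hj, gauge_smul_of_nonneg hs, ← hj, hjx x hx, smul_eq_mul, mul_one]
  have hΨ : ∀ x ∈ frontier Ω, ∀ s : ℝ, 0 < s →
      Ψ (s • (x - q)) = x - (2 * (1 - s)) • ζ := fun x hx s hs => by
    simp only [Ψ, hjB x hx s hs.le, smul_smul, inv_mul_cancel₀ hs.ne', one_smul]
    abel_nf
  have hlip : LipschitzOnWith (2 + 2 * K * R.toNNReal + 2 * K * ‖ζ‖₊) Ψ B := by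
    refine LipschitzOnWith.of_dist_le_mul ?_
    rintro _ ⟨x, ⟨hx, -⟩, s, hs, hs1, rfl⟩ _ ⟨y, ⟨hy, -⟩, t, ht, ht1, rfl⟩
    have hs0 : 0 < s := by linarith
    have ht0 : 0 < t := by linarith
    have hst : |s - t| ≤ K * ‖s • (x - q) - t • (y - q)‖ := by
      have := hK.dist_le_mul (s • (x - q)) (t • (y - q))
      rwa [hjB x hx s hs0.le, hjB y hy t ht0.le, Real.dist_eq, dist_eq_norm] at this
    rw [hΨ x hx s hs0, hΨ y hy t ht0, dist_eq_norm, dist_eq_norm]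
    set d := ‖s • (x - q) - t • (y - q)‖ with hd
    have h1 : x - (2 * (1 - s)) • ζ - (y - (2 * (1 - t)) • ζ) =
        s⁻¹ • (s • (x - q) - t • (y - q)) + (s⁻¹ * (t - s)) • (y - q) + (2 * (s - t)) • ζ := by
      match_scalars <;> field_simp <;> ring
    have hs2 : s⁻¹ ≤ 2 := by
      rw [inv_le_comm₀ hs0 two_pos]
      linarith
    have hsi : 0 < s⁻¹ := inv_pos.2 hs0
    rw [h1]
    refine (norm_add₃_le).trans ?_
    rw [norm_smul, norm_smul, norm_smul, norm_mul, norm_mul, Real.norm_eq_abs, Real.norm_eq_abs,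
      Real.norm_eq_abs, Real.norm_eq_abs, abs_of_pos hsi, abs_two, abs_sub_comm t s, ← hd]
    push_cast
    rw [Real.coe_toNNReal _ hR0.le]
    have e1 : s⁻¹ * d ≤ 2 * d := by gcongr
    have e2 : s⁻¹ * |s - t| * ‖y - q‖ ≤ 2 * (K * d) * R := by
      gcongr
      exact hRx y hy
    have e3 : 2 * |s - t| * ‖ζ‖ ≤ 2 * (K * d) * ‖ζ‖ := by gcongr
    linarith
  have hsub : sweep ζ (frontier Ω \ smoothBoundary Ω) ⊆ Ψ '' B := by
    rintro z ⟨x, hx, t, ht0, ht1, rfl⟩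
    refine ⟨(1 - t / 2) • (x - q), ⟨x, hx, _, by linarith, by linarith, rfl⟩, ?_⟩
    rw [hΨ x hx.1 _ (by linarith)]
    congr 2
    ring
  refine measure_mono_null hsub ?_
  have := hlip.euclideanHausdorffMeasure_image_le n
  rw [EuclideanSpace.euclideanHausdorffMeasure_eq_volume, hB, mul_zero] at this
  exact nonpos_iff_eq_zero.1 this

/-- A piece `E` of the boundary sweeps out in direction `ζ` at most the volume
`∫_E |⟪ζ, ν⟫|`. -/
theorem volume_sweep_le (hΩ : IsAdmissible Ω) (ζ : EuclideanSpace ℝ (Fin n))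
    {E : Set (EuclideanSpace ℝ (Fin n))} (hE : MeasurableSet E) (hEΩ : E ⊆ frontier Ω) :
    volume (sweep ζ E) ≤ ∫⁻ x in E, ENNReal.ofReal |⟪ζ, outerNormal Ω x⟫| ∂μHE[n - 1] := by
  set φ : EuclideanSpace ℝ (Fin n) → ℝ≥0∞ := fun x => ENNReal.ofReal |⟪ζ, outerNormal Ω x⟫|
  -- the estimate with an error `ε`, near each fixed direction
  have hlocal : ∀ ε : ℝ≥0, 0 < ε → ∀ ν : EuclideanSpace ℝ (Fin n), ∃ δ : ℝ, 0 < δ ∧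
      ∀ E' : Set (EuclideanSpace ℝ (Fin n)), E' ⊆ smoothBoundary Ω → MeasurableSet E' →
        (∀ x ∈ E', dist (outerNormal Ω x) ν < δ) →
          volume (sweep ζ E') ≤ ∫⁻ x in E', (φ x + ε) ∂μHE[n - 1] := by
    intro ε hε ν
    by_cases hν : ‖ν‖ = 1
    · have hε2 : 0 < ε / 2 := by positivity
      obtain ⟨δ, hδ, hsw⟩ := exists_volume_sweep_le hν ζ (m := |⟪ζ, ν⟫|.toNNReal + ε / 2) (by
        rw [ENNReal.ofReal]
        exact_mod_cast lt_add_of_pos_right _ hε2)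
      have hcont : ContinuousAt (fun v => |⟪ζ, v⟫|) ν := by fun_prop
      obtain ⟨δ', hδ', hclose⟩ := Metric.continuousAt_iff.1 hcont (ε / 2) (by exact_mod_cast hε2)
      refine ⟨min δ δ', lt_min hδ hδ', fun E' hE'D hE' hnear => ?_⟩
      refine (hsw E' fun x hx y hy => ?_).trans ?_
      · refine abs_inner_sub_le (hE'D hx).1 (hE'D hy).1 (outerNormal_spec (hE'D hx))
          (outerNormal_spec (hE'D hy)) ?_ ?_
        · rw [← dist_eq_norm]
          exact ((hnear x hx).trans_le (min_le_left _ _)).le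
        · rw [← dist_eq_norm]
          exact ((hnear y hy).trans_le (min_le_left _ _)).le
      · rw [← setLIntegral_const]
        refine setLIntegral_mono' hE' fun x hx => ?_
        have h1 := hclose ((hnear x hx).trans_le (min_le_right _ _))
        rw [Real.dist_eq, abs_lt] at h1
        have h2 : |⟪ζ, ν⟫|.toNNReal ≤ |⟪ζ, outerNormal Ω x⟫|.toNNReal + ε / 2 := by
          rw [Real.toNNReal_le_iff_le_coe]
          push_cast
          rw [Real.coe_toNNReal _ (abs_nonneg _)]
          linarith [h1.1]
        have h3 : |⟪ζ, ν⟫|.toNNReal + ε / 2 ≤ |⟪ζ, outerNormal Ω x⟫|.toNNReal + ε := by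
          calc _ ≤ |⟪ζ, outerNormal Ω x⟫|.toNNReal + ε / 2 + ε / 2 := by gcongr
            _ = _ := by rw [add_assoc, add_halves]
        simp only [φ, ENNReal.ofReal]
        exact_mod_cast h3
    · refine ⟨|‖ν‖ - 1|, abs_pos.2 (sub_ne_zero.2 hν), fun E' hE'D _ hnear => ?_⟩
      have : E' = ∅ := by
        rw [eq_empty_iff_forall_notMem]
        intro x hx
        have h1 := hnear x hx
        have h2 := abs_norm_sub_norm_le ν (outerNormal Ω x)
        rw [(outerNormal_spec (hE'D hx)).1, ← dist_eq_norm, dist_comm] at h2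
        linarith
      subst this
      simp [sweep]
  have hDm := measurableSet_smoothBoundary hΩ
  have hfin : μHE[n - 1] E < ⊤ := (measure_mono hEΩ).trans_lt hΩ.measure_frontier_lt_top
  have hφm : Measurable ((smoothBoundary Ω).indicator (outerNormal Ω)) :=
    measurable_indicator_outerNormal hΩ
  have hε : ∀ ε : ℝ≥0, 0 < ε →
      volume (sweep ζ E) ≤ (∫⁻ x in E, φ x ∂μHE[n - 1]) + ε * μHE[n - 1] E := by
    intro ε hε
    choose δ hδ hsw using hlocal ε hε
    obtain ⟨N, hNc, hN⟩ := TopologicalSpace.countable_cover_nhds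
      (f := fun ν => Metric.ball ν (δ ν)) (fun ν => Metric.ball_mem_nhds ν (hδ ν))
    have hNne : N.Nonempty := by
      by_contra h
      rw [not_nonempty_iff_eq_empty] at h
      subst h
      rw [biUnion_empty] at hN
      exact empty_ne_univ hN
    obtain ⟨u, rfl⟩ := hNc.exists_eq_range hNne
    rw [biUnion_range] at hN
    set V : ℕ → Set (EuclideanSpace ℝ (Fin n)) :=
      disjointed fun i => Metric.ball (u i) (δ (u i)) with hV
    have hVm : ∀ i, MeasurableSet (V i) :=
      MeasurableSet.disjointed fun i => measurableSet_ball
    have hVu : ⋃ i, V i = univ := by rw [hV, iUnion_disjointed, hN]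
    let P : ℕ → Set (EuclideanSpace ℝ (Fin n)) := fun i =>
      (E ∩ smoothBoundary Ω) ∩ (smoothBoundary Ω).indicator (outerNormal Ω) ⁻¹' V i
    have hPm : ∀ i, MeasurableSet (P i) := fun i => (hE.inter hDm).inter (hφm (hVm i))
    have hPu : ⋃ i, P i = E ∩ smoothBoundary Ω := by
      rw [← inter_iUnion, ← preimage_iUnion, hVu, preimage_univ, inter_univ]
    have hPd : Pairwise (Function.onFun Disjoint P) := fun i k hik =>
      ((disjoint_disjointed _ hik).preimage _).mono inter_subset_right inter_subset_right
    have hP : ∀ i, volume (sweep ζ (P i)) ≤ ∫⁻ x in P i, (φ x + ε) ∂μHE[n - 1] := fun i => by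
      refine hsw (u i) (P i) (fun x hx => hx.1.2) (hPm i) fun x hx => ?_
      have := hx.2
      rw [mem_preimage, indicator_of_mem hx.1.2] at this
      exact disjointed_subset _ i this
    have hnull : volume (sweep ζ (E \ smoothBoundary Ω)) = 0 :=
      measure_mono_null (sweep_mono (sdiff_subset_sdiff_left hEΩ))
        (volume_sweep_diff_smoothBoundary hΩ ζ)
    calc volume (sweep ζ E)
        = volume (sweep ζ (E ∩ smoothBoundary Ω) ∪ sweep ζ (E \ smoothBoundary Ω)) := by
          rw [← sweep_union, inter_union_sdiff]
      _ ≤ volume (sweep ζ (E ∩ smoothBoundary Ω)) + 0 := by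
          rw [← hnull]
          exact measure_union_le _ _
      _ ≤ ∑' i, volume (sweep ζ (P i)) := by
          rw [add_zero, ← hPu, sweep_iUnion]
          exact measure_iUnion_le _
      _ ≤ ∑' i, ∫⁻ x in P i, (φ x + ε) ∂μHE[n - 1] := ENNReal.tsum_le_tsum hP
      _ = ∫⁻ x in E ∩ smoothBoundary Ω, (φ x + ε) ∂μHE[n - 1] := by
          rw [← hPu, lintegral_iUnion hPm hPd]
      _ ≤ ∫⁻ x in E, (φ x + ε) ∂μHE[n - 1] := lintegral_mono_set inter_subset_left
      _ = _ := by
          rw [lintegral_add_right _ measurable_const, setLIntegral_const]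
  refine ENNReal.le_of_forall_pos_le_add fun ε hε0 _ => ?_
  have hM : 0 < (μHE[n - 1] E).toNNReal + 1 := by positivity
  refine (hε (ε / ((μHE[n - 1] E).toNNReal + 1)) (by positivity)).trans ?_
  gcongr
  rw [← ENNReal.coe_toNNReal hfin.ne]
  norm_cast
  rw [div_mul_eq_mul_div, div_le_iff₀ hM]
  gcongr
  exact le_self_add

/-! ### A divergence inequality on caps -/

theorem isLinearMap_inner_left (ν : EuclideanSpace ℝ (Fin n)) :
    IsLinearMap ℝ fun x : EuclideanSpace ℝ (Fin n) => ⟪x, ν⟫ :=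
  ⟨fun _ _ => inner_add_left _ _ _, fun _ _ => by simp [inner_smul_left]⟩

theorem isOpen_setOf_lt_inner (ν : EuclideanSpace ℝ (Fin n)) (c : ℝ) :
    IsOpen {x : EuclideanSpace ℝ (Fin n) | c < ⟪x, ν⟫} :=
  isOpen_lt continuous_const (by fun_prop)

theorem measurableSet_setOf_inner_eq (ν : EuclideanSpace ℝ (Fin n)) (c : ℝ) :
    MeasurableSet {x : EuclideanSpace ℝ (Fin n) | ⟪x, ν⟫ = c} :=
  measurableSet_eq_fun (by fun_prop) measurable_const

theorem measurableSet_setOf_add_mem (hΩ : IsOpen Ω) (v : EuclideanSpace ℝ (Fin n)) :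
    MeasurableSet {x | x + v ∈ Ω} :=
  (hΩ.preimage (f := fun z => z + v) (by fun_prop)).measurableSet

theorem exists_mem_segment_frontier (hΩ : IsOpen Ω) {z w : EuclideanSpace ℝ (Fin n)}
    (hz : z ∈ Ω) (hw : w ∉ Ω) : ∃ x ∈ segment ℝ z w, x ∈ frontier Ω := by
  by_contra! h
  have hclosure : ∀ x ∈ segment ℝ z w, x ∉ Ω → x ∈ (closure Ω)ᶜ := fun x hx hxΩ hxc => by
    refine h x hx ?_
    rw [hΩ.frontier_eq]
    exact ⟨hxc, hxΩ⟩
  obtain ⟨x, -, hx, hx'⟩ := (convex_segment z w).isPreconnected Ω (closure Ω)ᶜ hΩ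
    isClosed_closure.isOpen_compl (fun x hx => or_iff_not_imp_left.2 (hclosure x hx))
    ⟨z, left_mem_segment ℝ z w, hz⟩ ⟨w, right_mem_segment ℝ z w,
      hclosure w (right_mem_segment ℝ z w) hw⟩
  exact hx' (subset_closure hx)

/-- Points of the cap `{c < ⟪·, ν⟫}` of `Ω` that leave `Ω` when moved by `τ • ζ` are swept out by
the boundary part of the cap; this bounds the integral over such points of a function `g` that
increases along `ζ`. -/
theorem lintegral_exit_le (hΩ : IsAdmissible Ω) {ν ζ : EuclideanSpace ℝ (Fin n)}
    (hζ : 0 < ⟪ζ, ν⟫) (c : ℝ) {g : EuclideanSpace ℝ (Fin n) → ℝ} (hg : Continuous g)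
    (hg0 : ∀ z ∈ closure Ω, c < ⟪z, ν⟫ → 0 ≤ g z)
    (hgmono : ∀ z ∈ Ω, c < ⟪z, ν⟫ → ∀ t : ℝ, 0 ≤ t → z + t • ζ ∈ closure Ω → g z ≤ g (z + t • ζ))
    {τ : ℝ} (hτ : 0 < τ) :
    ∫⁻ z in {z ∈ Ω | c < ⟪z, ν⟫ ∧ z + τ • ζ ∉ Ω}, ENNReal.ofReal (g z) ≤
      ENNReal.ofReal τ * ∫⁻ x in frontier Ω ∩ {x | c < ⟪x, ν⟫},
        ENNReal.ofReal |⟪ζ, outerNormal Ω x⟫| * ENNReal.ofReal (g x) ∂μHE[n - 1] := by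
  set S := frontier Ω ∩ {x | c < ⟪x, ν⟫} with hS
  set B := {z ∈ Ω | c < ⟪z, ν⟫ ∧ z + τ • ζ ∉ Ω} with hB
  have hSm : MeasurableSet S := isClosed_frontier.measurableSet.inter
    (isOpen_setOf_lt_inner ν c).measurableSet
  have hBm : MeasurableSet B := hΩ.isOpen.measurableSet.inter
    ((isOpen_setOf_lt_inner ν c).measurableSet.inter
      (measurableSet_setOf_add_mem hΩ.isOpen (τ • ζ)).compl)
  set φ : EuclideanSpace ℝ (Fin n) → ℝ≥0∞ := fun x =>
    ENNReal.ofReal |⟪ζ, (smoothBoundary Ω).indicator (outerNormal Ω) x⟫| with hφ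
  have hφm : Measurable φ := by
    have := measurable_indicator_outerNormal hΩ
    exact ENNReal.measurable_ofReal.comp (measurable_const.inner this).abs
  have hφS : ∀ x ∈ S, φ x = ENNReal.ofReal |⟪ζ, outerNormal Ω x⟫| := fun x hx => by
    rw [hφ]
    simp only
    rw [indicator_outerNormal_eq hx.1]
  set m : Measure (EuclideanSpace ℝ (Fin n)) := (μHE[n - 1].restrict S).withDensity φ with hm
  have hint : ∫⁻ x in S, ENNReal.ofReal |⟪ζ, outerNormal Ω x⟫| * ENNReal.ofReal (g x) ∂μHE[n - 1]
      = ∫⁻ x, ENNReal.ofReal (g x) ∂m := by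
    rw [hm, lintegral_withDensity_eq_lintegral_mul _ hφm (by fun_prop)]
    refine setLIntegral_congr_fun hSm fun x hx => ?_
    simp only [Pi.mul_apply, hφS x hx]
  have hm0 : 0 ≤ᵐ[m] g := (withDensity_absolutelyContinuous _ _).ae_le
    (ae_restrict_of_forall_mem hSm fun x hx => hg0 x (frontier_subset_closure hx.1) hx.2)
  -- by the layer cake formula it suffices to treat the superlevel sets of `g`
  rw [hint, lintegral_eq_lintegral_meas_le _ hm0 hg.aemeasurable, lintegral_eq_lintegral_meas_le _
    (ae_restrict_of_forall_mem hBm fun z hz => hg0 z (subset_closure hz.1) hz.2.1) hg.aemeasurable,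
    ← lintegral_const_mul' _ _ ENNReal.ofReal_ne_top]
  refine lintegral_mono fun t => ?_
  have htm : MeasurableSet {x | t ≤ g x} := measurableSet_le measurable_const hg.measurable
  rw [Measure.restrict_apply htm, hm, withDensity_apply _ htm, Measure.restrict_restrict htm]
  have hsub : {x | t ≤ g x} ∩ B ⊆ sweep (τ • ζ) ({x | t ≤ g x} ∩ S) := by
    rintro z ⟨hzt, hzΩ, hzc, hzτ⟩
    obtain ⟨x, hxseg, hxf⟩ := exists_mem_segment_frontier hΩ.isOpen hzΩ hzτ
    rw [segment_eq_image'] at hxseg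
    obtain ⟨s, ⟨hs0, hs1⟩, rfl⟩ := hxseg
    simp only [add_sub_cancel_left] at hxf
    have hs : 0 < s := by
      refine lt_of_le_of_ne hs0 fun h => ?_
      rw [← h, zero_smul, add_zero, hΩ.isOpen.frontier_eq] at hxf
      exact hxf.2 hzΩ
    refine ⟨z + s • τ • ζ, ⟨?_, hxf, ?_⟩, s, hs, hs1, by abel⟩
    · have := hgmono z hzΩ hzc (s * τ) (by positivity)
        (by rw [mul_smul]; exact frontier_subset_closure hxf)
      rw [mul_smul] at this
      exact le_trans hzt this
    · have : 0 ≤ s * (τ * ⟪ζ, ν⟫) := by positivity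
      simp only [mem_ofPred_eq, inner_add_left, inner_smul_left, conj_trivial]
      linarith
  refine (measure_mono hsub).trans ((volume_sweep_le hΩ _ (htm.inter hSm)
    (inter_subset_right.trans inter_subset_left)).trans ?_)
  rw [← lintegral_const_mul' _ _ ENNReal.ofReal_ne_top]
  refine setLIntegral_mono' (htm.inter hSm) fun x hx => ?_
  rw [hφS x hx.2, ← ENNReal.ofReal_mul hτ.le, inner_smul_left, conj_trivial, abs_mul,
    abs_of_pos hτ]

/-- The part of the cap just above its flat face `{⟪·, ν⟫ = c}` carries at least the integral of `g`
over the face, times the thickness. -/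
theorem le_lintegral_entry (hΩ : IsAdmissible Ω) {ν ζ : EuclideanSpace ℝ (Fin n)}
    (hν : ‖ν‖ = 1) (hζ : 0 < ⟪ζ, ν⟫) (c : ℝ) {g : EuclideanSpace ℝ (Fin n) → ℝ} (hg : Continuous g)
    (hg0 : ∀ z ∈ Ω, c ≤ ⟪z, ν⟫ → 0 ≤ g z)
    (hgmono : ∀ z ∈ Ω, c ≤ ⟪z, ν⟫ → ∀ t : ℝ, 0 ≤ t → z + t • ζ ∈ Ω → g z ≤ g (z + t • ζ))
    {τ : ℝ} (hτ : 0 < τ) :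
    ENNReal.ofReal τ * (ENNReal.ofReal ⟪ζ, ν⟫ *
      ∫⁻ y in {y ∈ Ω | ⟪y, ν⟫ = c ∧ y + τ • ζ ∈ Ω}, ENNReal.ofReal (g y) ∂μHE[n - 1]) ≤
    ∫⁻ z in {z ∈ Ω | c < ⟪z, ν⟫ ∧ ⟪z - τ • ζ, ν⟫ ≤ c}, ENNReal.ofReal (g z) := by
  set T := {y ∈ Ω | ⟪y, ν⟫ = c ∧ y + τ • ζ ∈ Ω} with hT
  set D := {z ∈ Ω | c < ⟪z, ν⟫ ∧ ⟪z - τ • ζ, ν⟫ ≤ c} with hD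
  have hTm : MeasurableSet T := hΩ.isOpen.measurableSet.inter
    ((measurableSet_setOf_inner_eq ν c).inter (measurableSet_setOf_add_mem hΩ.isOpen (τ • ζ)))
  have hDm : MeasurableSet D := hΩ.isOpen.measurableSet.inter
    ((isOpen_setOf_lt_inner ν c).measurableSet.inter
      (measurableSet_le (f := fun z => ⟪z - τ • ζ, ν⟫) (by fun_prop) measurable_const))
  rw [lintegral_eq_lintegral_meas_le _
    (ae_restrict_of_forall_mem hTm fun z hz => hg0 z hz.1 hz.2.1.ge) hg.aemeasurable,
    lintegral_eq_lintegral_meas_le _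
    (ae_restrict_of_forall_mem hDm fun z hz => hg0 z hz.1 hz.2.1.le) hg.aemeasurable,
    ← lintegral_const_mul' _ _ ENNReal.ofReal_ne_top,
    ← lintegral_const_mul' _ _ ENNReal.ofReal_ne_top]
  refine lintegral_mono fun t => ?_
  have htm : MeasurableSet {x | t ≤ g x} := measurableSet_le measurable_const hg.measurable
  simp only
  rw [Measure.restrict_apply htm, Measure.restrict_apply htm, mul_left_comm,
    ← volume_cylinder hν hζ (htm.inter hTm) (fun y hy => hy.2.2.1) hτ.le]
  refine measure_mono ?_
  rintro _ ⟨y, ⟨hyt, hyΩ, hyc, hyτ⟩, s, hs0, hs1, rfl⟩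
  have hmem : y + s • ζ ∈ Ω := by
    have := hΩ.convex.add_smul_sub_mem hyΩ hyτ (t := s / τ)
      ⟨by positivity, (div_le_one hτ).2 hs1⟩
    rwa [add_sub_cancel_left, smul_smul, div_mul_cancel₀ _ hτ.ne'] at this
  refine ⟨le_trans hyt (hgmono y hyΩ hyc.ge s hs0.le hmem), hmem, ?_, ?_⟩
  · simp only [inner_add_left, inner_smul_left, conj_trivial, hyc]
    have : 0 < s * ⟪ζ, ν⟫ := by positivity
    linarith
  · simp only [inner_add_left, inner_sub_left, inner_smul_left, conj_trivial, hyc]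
    nlinarith

/-- One-sided divergence theorem for the field `g ζ` on the cap `{c < ⟪·, ν⟫}` of a convex set,
where `g` grows along `ζ` at rate at least `κ`. Integrating `g` over the cap and over its translate
by `τ • ζ` compares the flow through the boundary with the flow through the flat face; then
`τ → 0`. -/
theorem divergence_cap_le (hΩ : IsAdmissible Ω) {ν ζ : EuclideanSpace ℝ (Fin n)}
    (hν : ‖ν‖ = 1) (hζ : 0 < ⟪ζ, ν⟫) (c : ℝ) {g : EuclideanSpace ℝ (Fin n) → ℝ} (hg : Continuous g)
    {κ : ℝ} (hκ : 0 ≤ κ) (hg0 : ∀ z ∈ closure Ω, c ≤ ⟪z, ν⟫ → 0 ≤ g z)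
    (hgmono : ∀ z ∈ Ω, c ≤ ⟪z, ν⟫ → ∀ t : ℝ, 0 ≤ t → z + t • ζ ∈ closure Ω →
      g z + κ * t ≤ g (z + t • ζ)) :
    ENNReal.ofReal ⟪ζ, ν⟫ * ∫⁻ y in {y ∈ Ω | ⟪y, ν⟫ = c}, ENNReal.ofReal (g y) ∂μHE[n - 1] +
      ENNReal.ofReal κ * volume {z ∈ Ω | c < ⟪z, ν⟫} ≤
    ∫⁻ x in frontier Ω ∩ {x | c < ⟪x, ν⟫},
      ENNReal.ofReal |⟪ζ, outerNormal Ω x⟫| * ENNReal.ofReal (g x) ∂μHE[n - 1] := by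
  have hmono' : ∀ z ∈ Ω, c ≤ ⟪z, ν⟫ → ∀ t : ℝ, 0 ≤ t → z + t • ζ ∈ closure Ω →
      g z ≤ g (z + t • ζ) := fun z hz hzc t ht hzt =>
    le_trans (by nlinarith [mul_nonneg hκ ht]) (hgmono z hz hzc t ht hzt)
  set I := ∫⁻ x in frontier Ω ∩ {x | c < ⟪x, ν⟫},
      ENNReal.ofReal |⟪ζ, outerNormal Ω x⟫| * ENNReal.ofReal (g x) ∂μHE[n - 1]
  set A := {z ∈ Ω | c < ⟪z, ν⟫} with hA
  have hAopen : IsOpen A := hΩ.isOpen.inter (isOpen_setOf_lt_inner ν c)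
  have hAconv : Convex ℝ A := by
    exact hΩ.convex.inter (convex_halfSpace_gt (isLinearMap_inner_left ν) c)
  have hAfin : ∫⁻ z in A, ENNReal.ofReal (g z) < ⊤ := by
    refine (lintegral_mono_set (inter_subset_left.trans subset_closure)).trans_lt ?_
    exact (hg.continuousOn.integrableOn_compact hΩ.isCompact_closure).lintegral_lt_top
  -- the inequality at a fixed translation length
  have hτ : ∀ τ : ℝ, 0 < τ → ENNReal.ofReal ⟪ζ, ν⟫ *
      ∫⁻ y in {y ∈ Ω | ⟪y, ν⟫ = c ∧ y + τ • ζ ∈ Ω}, ENNReal.ofReal (g y) ∂μHE[n - 1] +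
      ENNReal.ofReal κ * volume {z ∈ A | z - τ • ζ ∈ A} ≤ I := by
    intro τ hτ
    set A₁ := {z ∈ A | z + τ • ζ ∈ Ω} with hA₁
    set A₂ := {z ∈ A | z - τ • ζ ∈ A} with hA₂
    have hA₁m : MeasurableSet A₁ := hAopen.measurableSet.inter
      (hΩ.isOpen.measurableSet.preimage (f := fun z => z + τ • ζ) (by fun_prop))
    have hA₂m : MeasurableSet A₂ := hAopen.measurableSet.inter
      (hAopen.measurableSet.preimage (f := fun z => z - τ • ζ) (by fun_prop))
    have e1 := lintegral_exit_le hΩ hζ c hg (fun z hz hzc => hg0 z hz hzc.le)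
      (fun z hz hzc => hmono' z hz hzc.le) hτ
    have e2 := le_lintegral_entry hΩ hν hζ c hg (fun z hz => hg0 z (subset_closure hz))
      (fun z hz hzc t ht hzt => hmono' z hz hzc t ht (subset_closure hzt)) hτ
    have e3 : ∫⁻ z in A₁, ENNReal.ofReal (g z) = ∫⁻ z in A₂, ENNReal.ofReal (g (z - τ • ζ)) := by
      have : A₁ = (fun z => z + τ • ζ) ⁻¹' A₂ := by
        ext z
        simp only [hA₁, hA₂, hA, mem_preimage, mem_ofPred_eq, add_sub_cancel_right,
          inner_add_left, inner_smul_left, conj_trivial]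
        have : 0 < τ * ⟪ζ, ν⟫ := by positivity
        constructor
        · rintro ⟨⟨h1, h2⟩, h3⟩
          exact ⟨⟨h3, by linarith⟩, h1, h2⟩
        · rintro ⟨⟨h1, -⟩, h3⟩
          exact ⟨h3, h1⟩
      rw [this, ← (measurePreserving_add_right volume (τ • ζ)).setLIntegral_comp_preimage hA₂m
        (by fun_prop)]
      simp
    have e4 : (∫⁻ z in A₂, ENNReal.ofReal (g (z - τ • ζ))) + ENNReal.ofReal (κ * τ) * volume A₂ ≤
        ∫⁻ z in A₂, ENNReal.ofReal (g z) := by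
      rw [← setLIntegral_const, ← lintegral_add_right _ measurable_const]
      refine setLIntegral_mono' hA₂m fun z hz => ?_
      have h := hgmono (z - τ • ζ) hz.2.1 hz.2.2.le τ hτ.le
        (by rw [sub_add_cancel]; exact subset_closure hz.1.1)
      rw [sub_add_cancel] at h
      rw [← ENNReal.ofReal_add (hg0 _ (subset_closure hz.2.1) hz.2.2.le) (by positivity)]
      exact ENNReal.ofReal_le_ofReal h
    have e5 : (∫⁻ z in A₁, ENNReal.ofReal (g z)) +
        ∫⁻ z in {z ∈ Ω | c < ⟪z, ν⟫ ∧ z + τ • ζ ∉ Ω}, ENNReal.ofReal (g z) =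
        ∫⁻ z in A, ENNReal.ofReal (g z) := by
      rw [← lintegral_inter_add_sdiff (fun z => ENNReal.ofReal (g z)) A hA₁m]
      have h1 : A ∩ A₁ = A₁ := inter_eq_right.2 fun z hz => hz.1
      have h2 : A \ A₁ = {z ∈ Ω | c < ⟪z, ν⟫ ∧ z + τ • ζ ∉ Ω} := by
        ext z
        simp only [hA₁, hA, mem_sdiff, mem_ofPred_eq]
        tauto
      rw [h1, h2]
    have e6 : (∫⁻ z in A₂, ENNReal.ofReal (g z)) +
        ∫⁻ z in {z ∈ Ω | c < ⟪z, ν⟫ ∧ ⟪z - τ • ζ, ν⟫ ≤ c}, ENNReal.ofReal (g z) ≤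
        ∫⁻ z in A, ENNReal.ofReal (g z) := by
      rw [← lintegral_inter_add_sdiff (fun z => ENNReal.ofReal (g z)) A hA₂m]
      gcongr ?_ + ?_
      · rw [inter_eq_right.2 fun z hz => hz.1]
      · refine lintegral_mono_set ?_
        rintro z ⟨h1, h2, h3⟩
        exact ⟨⟨h1, h2⟩, fun h => absurd h.2.2 (not_lt.2 h3)⟩
    have hA₁fin : ∫⁻ z in A₁, ENNReal.ofReal (g z) ≠ ⊤ :=
      ((lintegral_mono_set fun z hz => hz.1).trans_lt hAfin).ne
    have e7 : ENNReal.ofReal (κ * τ) * volume A₂ + ENNReal.ofReal τ * (ENNReal.ofReal ⟪ζ, ν⟫ *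
        ∫⁻ y in {y ∈ Ω | ⟪y, ν⟫ = c ∧ y + τ • ζ ∈ Ω}, ENNReal.ofReal (g y) ∂μHE[n - 1]) ≤
        ENNReal.ofReal τ * I := by
      refine le_trans ?_ e1
      rw [← ENNReal.add_le_add_iff_left hA₁fin, e5, ← add_assoc]
      refine le_trans ?_ e6
      gcongr
      rwa [e3]
    rw [mul_comm κ, ENNReal.ofReal_mul hτ.le, mul_assoc, ← mul_add, ENNReal.mul_le_mul_iff_right
      (ENNReal.ofReal_pos.2 hτ).ne' ENNReal.ofReal_ne_top, add_comm] at e7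
    exact e7
  -- letting the translation length tend to zero
  set u : ℕ → ℝ := fun k => 1 / ((k : ℝ) + 1) with hu
  have hu0 : ∀ k, 0 < u k := fun k => by positivity
  have hulim : Filter.Tendsto u Filter.atTop (𝓝 0) := tendsto_one_div_add_atTop_nhds_zero_nat
  have hanti : Antitone u := fun i k hik => by
    simp only [hu]
    gcongr
  have hshrink : ∀ {C : Set (EuclideanSpace ℝ (Fin n))}, Convex ℝ C →
      ∀ {v : EuclideanSpace ℝ (Fin n)}, ∀ z ∈ C, ∀ i k, i ≤ k → z + u i • v ∈ C →
        z + u k • v ∈ C := by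
    intro C hC v z hz i k hik h
    have := hC.add_smul_sub_mem hz h (t := u k / u i)
      ⟨by have := hu0 k; have := hu0 i; positivity, (div_le_one (hu0 i)).2 (hanti hik)⟩
    rwa [add_sub_cancel_left, smul_smul, div_mul_cancel₀ _ (hu0 i).ne'] at this
  have hreach : ∀ {C : Set (EuclideanSpace ℝ (Fin n))}, IsOpen C →
      ∀ {v : EuclideanSpace ℝ (Fin n)}, ∀ z ∈ C, ∃ k, z + u k • v ∈ C := by
    intro C hC v z hz
    have hc : Filter.Tendsto (fun k => z + u k • v) Filter.atTop (𝓝 (z + (0 : ℝ) • v)) :=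
      tendsto_const_nhds.add (hulim.smul_const v)
    rw [zero_smul, add_zero] at hc
    exact (hc.eventually_mem (hC.mem_nhds hz)).exists
  set T : ℕ → Set (EuclideanSpace ℝ (Fin n)) := fun k =>
    {y ∈ Ω | ⟪y, ν⟫ = c ∧ y + u k • ζ ∈ Ω} with hT
  set A' : ℕ → Set (EuclideanSpace ℝ (Fin n)) := fun k => {z ∈ A | z - u k • ζ ∈ A} with hA'
  have hTmono : Monotone T := fun i k hik y hy =>
    ⟨hy.1, hy.2.1, hshrink hΩ.convex y hy.1 i k hik hy.2.2⟩
  have hA'mono : Monotone A' := fun i k hik z hz => by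
    refine ⟨hz.1, ?_⟩
    have := hshrink hAconv (v := -ζ) z hz.1 i k hik
      (by rw [smul_neg, ← sub_eq_add_neg]; exact hz.2)
    rwa [smul_neg, ← sub_eq_add_neg] at this
  have hTU : ⋃ k, T k = {y ∈ Ω | ⟪y, ν⟫ = c} := by
    ext y
    rw [mem_iUnion]
    constructor
    · rintro ⟨k, h1, h2, -⟩
      exact ⟨h1, h2⟩
    · rintro ⟨h1, h2⟩
      obtain ⟨k, hk⟩ := hreach hΩ.isOpen (v := ζ) y h1
      exact ⟨k, h1, h2, hk⟩
  have hA'U : ⋃ k, A' k = A := by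
    ext z
    rw [mem_iUnion]
    constructor
    · rintro ⟨k, h1, -⟩
      exact h1
    · intro h1
      obtain ⟨k, hk⟩ := hreach hAopen (v := -ζ) z h1
      rw [smul_neg, ← sub_eq_add_neg] at hk
      exact ⟨k, h1, hk⟩
  have hTm : ∀ k, MeasurableSet (T k) := fun k => hΩ.isOpen.measurableSet.inter
    ((measurableSet_setOf_inner_eq ν c).inter (measurableSet_setOf_add_mem hΩ.isOpen (u k • ζ)))
  have l1 : Filter.Tendsto (fun k => ∫⁻ y in T k, ENNReal.ofReal (g y) ∂μHE[n - 1]) Filter.atTop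
      (𝓝 (∫⁻ y in {y ∈ Ω | ⟪y, ν⟫ = c}, ENNReal.ofReal (g y) ∂μHE[n - 1])) := by
    have h := tendsto_measure_iUnion_atTop
      (μ := (μHE[n - 1] : Measure (EuclideanSpace ℝ (Fin n))).withDensity
        fun y => ENNReal.ofReal (g y)) hTmono
    rw [withDensity_apply _ (MeasurableSet.iUnion hTm), hTU] at h
    refine h.congr fun k => ?_
    rw [Function.comp_apply, withDensity_apply _ (hTm k)]
  have l2 : Filter.Tendsto (fun k => volume (A' k)) Filter.atTop (𝓝 (volume A)) := by
    have h := tendsto_measure_iUnion_atTop (μ := volume) hA'mono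
    rwa [hA'U] at h
  exact le_of_tendsto' ((ENNReal.Tendsto.const_mul l1 (Or.inr ENNReal.ofReal_ne_top)).add
    (ENNReal.Tendsto.const_mul l2 (Or.inr ENNReal.ofReal_ne_top))) fun k => hτ (u k) (hu0 k)

/-! ### Finsler norms and their polars -/

namespace IsFinslerNorm

theorem continuous (hF : IsFinslerNorm p F) : Continuous F :=
  continuousOn_univ.1 (hF.convex.continuousOn isOpen_univ)

theorem map_zero (hF : IsFinslerNorm p F) : F 0 = 0 := by
  simpa using hF.homogeneous 0 0

theorem pos (hF : IsFinslerNorm p F) {ξ : EuclideanSpace ℝ (Fin n)} (hξ : ξ ≠ 0) : 0 < F ξ := by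
  obtain ⟨a, ha, h⟩ := hF.coercive
  exact (mul_pos ha (norm_pos_iff.2 hξ)).trans_le (h ξ)

theorem map_neg (hF : IsFinslerNorm p F) (ξ : EuclideanSpace ℝ (Fin n)) : F (-ξ) = F ξ := by
  simpa using hF.homogeneous (-1) ξ

theorem exists_le_mul_norm (hF : IsFinslerNorm p F) : ∃ C : ℝ, 0 < C ∧ ∀ ξ, F ξ ≤ C * ‖ξ‖ := by
  obtain ⟨C, hC⟩ := (isCompact_sphere (0 : EuclideanSpace ℝ (Fin n)) 1).bddAbove_image
    hF.continuous.continuousOn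
  refine ⟨max C 1, by positivity, fun ξ => ?_⟩
  by_cases hξ : ξ = 0
  · simp [hξ, hF.map_zero]
  · have hn := norm_pos_iff.2 hξ
    have h1 : F (‖ξ‖⁻¹ • ξ) ≤ C := hC (mem_image_of_mem F (by
      rw [mem_sphere_zero_iff_norm, norm_smul, norm_inv, norm_norm, inv_mul_cancel₀ hn.ne']))
    rw [hF.homogeneous, abs_of_pos (inv_pos.2 hn), inv_mul_le_iff₀ hn] at h1
    rw [mul_comm]
    exact h1.trans (by gcongr; exact le_max_left _ _)

theorem bddAbove_polar (hF : IsFinslerNorm p F) (v : EuclideanSpace ℝ (Fin n)) :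
    BddAbove (range fun ξ : {ξ : EuclideanSpace ℝ (Fin n) // ξ ≠ 0} => ⟪ξ.1, v⟫ / F ξ.1) := by
  obtain ⟨a, ha, h⟩ := hF.coercive
  refine ⟨‖v‖ / a, ?_⟩
  rintro _ ⟨ξ, rfl⟩
  simp only
  rw [div_le_div_iff₀ (hF.pos ξ.2) ha]
  calc ⟪ξ.1, v⟫ * a ≤ ‖ξ.1‖ * ‖v‖ * a := by
        gcongr
        exact real_inner_le_norm _ _
    _ = ‖v‖ * (a * ‖ξ.1‖) := by ring
    _ ≤ ‖v‖ * F ξ.1 := by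
        gcongr
        exact h _

theorem inner_le (hF : IsFinslerNorm p F) (ξ v : EuclideanSpace ℝ (Fin n)) :
    ⟪ξ, v⟫ ≤ F ξ * polar F v := by
  by_cases hξ : ξ = 0
  · simp [hξ, hF.map_zero]
  · rw [mul_comm, ← div_le_iff₀ (hF.pos hξ)]
    exact le_ciSup (hF.bddAbove_polar v) ⟨ξ, hξ⟩

theorem abs_inner_le (hF : IsFinslerNorm p F) (ξ v : EuclideanSpace ℝ (Fin n)) :
    |⟪ξ, v⟫| ≤ F ξ * polar F v := by
  rw [abs_le']
  refine ⟨hF.inner_le ξ v, ?_⟩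
  rw [← inner_neg_left, ← hF.map_neg]
  exact hF.inner_le _ v

theorem polar_le (hF : IsFinslerNorm p F) {v : EuclideanSpace ℝ (Fin n)} {b : ℝ} (hb : 0 ≤ b)
    (h : ∀ ξ, ⟪ξ, v⟫ ≤ F ξ * b) : polar F v ≤ b :=
  Real.iSup_le (fun ξ => by
    rw [div_le_iff₀ (hF.pos ξ.2), mul_comm]
    exact h ξ.1) hb

theorem polar_nonneg (hF : IsFinslerNorm p F) (v : EuclideanSpace ℝ (Fin n)) : 0 ≤ polar F v := by
  by_cases hv : v = 0
  · subst hv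
    simp [polar]
  · have h := hF.inner_le v v
    have h1 := hF.pos hv
    have h2 : 0 ≤ ⟪v, v⟫ := real_inner_self_nonneg
    by_contra! hneg
    nlinarith

theorem polar_smul_le (hF : IsFinslerNorm p F) (t : ℝ) (v : EuclideanSpace ℝ (Fin n)) :
    polar F (t • v) ≤ |t| * polar F v := by
  refine hF.polar_le (mul_nonneg (abs_nonneg t) (hF.polar_nonneg v)) fun ξ => ?_
  rw [inner_smul_right]
  calc t * ⟪ξ, v⟫ ≤ |t * ⟪ξ, v⟫| := le_abs_self _
    _ = |t| * |⟪ξ, v⟫| := abs_mul _ _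
    _ ≤ |t| * (F ξ * polar F v) := by
        gcongr
        exact hF.abs_inner_le ξ v
    _ = _ := by ring

theorem polar_smul (hF : IsFinslerNorm p F) (t : ℝ) (v : EuclideanSpace ℝ (Fin n)) :
    polar F (t • v) = |t| * polar F v := by
  refine le_antisymm (hF.polar_smul_le t v) ?_
  by_cases ht : t = 0
  · simpa [ht] using hF.polar_nonneg _
  · have h := hF.polar_smul_le t⁻¹ (t • v)
    rw [inv_smul_smul₀ ht, abs_inv, ← div_eq_inv_mul, le_div_iff₀ (abs_pos.2 ht)] at h
    linarith

theorem polar_zero (hF : IsFinslerNorm p F) : polar F 0 = 0 := by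
  simpa using hF.polar_smul 0 0

theorem polar_neg (hF : IsFinslerNorm p F) (v : EuclideanSpace ℝ (Fin n)) :
    polar F (-v) = polar F v := by
  simpa using hF.polar_smul (-1) v

theorem polar_add_le (hF : IsFinslerNorm p F) (v w : EuclideanSpace ℝ (Fin n)) :
    polar F (v + w) ≤ polar F v + polar F w := by
  refine hF.polar_le (add_nonneg (hF.polar_nonneg v) (hF.polar_nonneg w)) fun ξ => ?_
  rw [inner_add_right, mul_add]
  exact add_le_add (hF.inner_le ξ v) (hF.inner_le ξ w)

theorem polar_pos (hF : IsFinslerNorm p F) {v : EuclideanSpace ℝ (Fin n)} (hv : v ≠ 0) :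
    0 < polar F v := by
  have h := hF.inner_le v v
  have h1 := hF.pos hv
  have h2 : 0 < ⟪v, v⟫ := real_inner_self_pos.2 hv
  by_contra! hneg
  nlinarith

theorem continuous_polar (hF : IsFinslerNorm p F) : Continuous (polar F) := by
  obtain ⟨a, ha, h⟩ := hF.coercive
  have hle : ∀ v, polar F v ≤ a⁻¹ * ‖v‖ := fun v => by
    refine hF.polar_le (by positivity) fun ξ => ?_
    refine (real_inner_le_norm _ _).trans ?_
    rw [← mul_assoc]
    gcongr
    rw [← div_eq_mul_inv, le_div_iff₀ ha, mul_comm]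
    exact h ξ
  refine (LipschitzWith.of_le_add_mul ⟨a⁻¹, by positivity⟩ fun v w => ?_).continuous
  have h1 := hF.polar_add_le w (v - w)
  rw [add_sub_cancel] at h1
  refine h1.trans ?_
  rw [dist_eq_norm]
  gcongr
  exact hle _

theorem convexOn_polar (hF : IsFinslerNorm p F) : ConvexOn ℝ univ (polar F) := by
  refine ⟨convex_univ, fun x _ y _ a b ha hb _ => ?_⟩
  have h := hF.polar_add_le (a • x) (b • y)
  rwa [hF.polar_smul, hF.polar_smul, abs_of_nonneg ha, abs_of_nonneg hb] at h

theorem exists_inner_eq (hF : IsFinslerNorm p F) (hn : n ≠ 0) (v : EuclideanSpace ℝ (Fin n)) :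
    ∃ ν, ‖ν‖ = 1 ∧ ⟪v, ν⟫ = F ν * polar F v := by
  have : Nontrivial (EuclideanSpace ℝ (Fin n)) := by
    have : NeZero n := ⟨hn⟩
    infer_instance
  have hpos : ∀ ξ ∈ Metric.sphere (0 : EuclideanSpace ℝ (Fin n)) 1, F ξ ≠ 0 := fun ξ hξ =>
    (hF.pos (ne_zero_of_mem_unit_sphere ⟨ξ, hξ⟩)).ne'
  have hcont : ContinuousOn (fun ξ => ⟪ξ, v⟫ / F ξ)
      (Metric.sphere (0 : EuclideanSpace ℝ (Fin n)) 1) :=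
    ContinuousOn.div (by fun_prop) hF.continuous.continuousOn hpos
  obtain ⟨ν, hν, hmax⟩ := (isCompact_sphere (0 : EuclideanSpace ℝ (Fin n)) 1).exists_isMaxOn
    (NormedSpace.sphere_nonempty.2 zero_le_one) hcont
  have hν1 : ‖ν‖ = 1 := mem_sphere_zero_iff_norm.1 hν
  have hνpos : 0 < F ν := lt_of_le_of_ne (hF.nonneg ν) (hpos ν hν).symm
  refine ⟨ν, hν1, le_antisymm (by rw [real_inner_comm]; exact hF.inner_le ν v) ?_⟩
  rw [real_inner_comm, mul_comm, ← le_div_iff₀ hνpos]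
  have hratio : ∀ ξ : EuclideanSpace ℝ (Fin n), ξ ≠ 0 → ⟪ξ, v⟫ ≤ F ξ * (⟪ν, v⟫ / F ν) := by
    intro ξ hξ
    have hn := norm_pos_iff.2 hξ
    have h1 : ⟪‖ξ‖⁻¹ • ξ, v⟫ / F (‖ξ‖⁻¹ • ξ) ≤ ⟪ν, v⟫ / F ν := hmax (by
      rw [mem_sphere_zero_iff_norm, norm_smul, norm_inv, norm_norm, inv_mul_cancel₀ hn.ne'])
    rw [inner_smul_left, hF.homogeneous, abs_of_pos (inv_pos.2 hn), conj_trivial,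
      mul_div_mul_left _ _ (inv_pos.2 hn).ne', div_le_iff₀ (hF.pos hξ), mul_comm] at h1
    exact h1
  have hν0 : ν ≠ 0 := ne_zero_of_mem_unit_sphere ⟨ν, hν⟩
  refine hF.polar_le ?_ fun ξ => ?_
  · have h1 := hratio (-ν) (neg_ne_zero.2 hν0)
    rw [inner_neg_left, hF.map_neg, mul_div_cancel₀ _ hνpos.ne'] at h1
    exact div_nonneg (by linarith) hνpos.le
  · by_cases hξ : ξ = 0
    · simp [hξ, hF.map_zero]
    · exact hratio ξ hξ

theorem exists_norm_le_mul_polar (hF : IsFinslerNorm p F) :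
    ∃ C : ℝ, 0 < C ∧ ∀ v, ‖v‖ ≤ C * polar F v := by
  obtain ⟨C, hC, hle⟩ := hF.exists_le_mul_norm
  refine ⟨C, hC, fun v => ?_⟩
  by_cases hv0 : v = 0
  · simp [hv0, hF.polar_zero]
  · have h1 := hF.inner_le v v
    rw [real_inner_self_eq_norm_sq] at h1
    have hn := norm_pos_iff.2 hv0
    have h2 : F v * polar F v ≤ C * ‖v‖ * polar F v :=
      mul_le_mul_of_nonneg_right (hle v) (hF.polar_nonneg v)
    nlinarith

theorem isBounded_polar_le (hF : IsFinslerNorm p F) (r : ℝ) :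
    Bornology.IsBounded {v | polar F v ≤ r} := by
  obtain ⟨C, hC, hle⟩ := hF.exists_norm_le_mul_polar
  refine (Metric.isBounded_closedBall (x := (0 : EuclideanSpace ℝ (Fin n))) (r := C * r)).subset
    fun v hv => ?_
  rw [mem_closedBall_zero_iff]
  exact (hle v).trans (mul_le_mul_of_nonneg_left hv hC.le)

theorem isCompact_polar_le (hF : IsFinslerNorm p F) (r : ℝ) : IsCompact {v | polar F v ≤ r} :=
  Metric.isCompact_of_isClosed_isBounded (isClosed_le hF.continuous_polar continuous_const)
    (hF.isBounded_polar_le r)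

/-- The open Wulff shapes of `F` are admissible. -/
theorem isAdmissible_polar_lt (hF : IsFinslerNorm p F) {r : ℝ} (hr : 0 < r) :
    IsAdmissible {v | polar F v < r} where
  nonempty := ⟨0, by simpa [hF.polar_zero] using hr⟩
  isOpen := isOpen_lt hF.continuous_polar continuous_const
  isBounded := (hF.isBounded_polar_le r).subset fun v hv => show polar F v ≤ r from le_of_lt hv
  convex := by simpa using hF.convexOn_polar.convex_lt r

theorem differentiableAt (hF : IsFinslerNorm p F) {ν : EuclideanSpace ℝ (Fin n)} (hν : ν ≠ 0) :
    DifferentiableAt ℝ F ν :=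
  (hF.contDiffOn.contDiffAt (isOpen_compl_singleton.mem_nhds hν)).differentiableAt (by norm_num)

/-- Since `F` is differentiable at `ν`, the Wulff shape `{F° ≤ r}` touches its supporting
hyperplane with normal `ν` in the single point `r ∇F(ν)`. -/
theorem eq_of_inner_eq (hF : IsFinslerNorm p F) {ν x y : EuclideanSpace ℝ (Fin n)} (hν : ν ≠ 0)
    {r : ℝ} (hx : polar F x ≤ r) (hy : polar F y ≤ r) (hxν : ⟪x, ν⟫ = F ν * r)
    (hyν : ⟪y, ν⟫ = F ν * r) : x = y := by
  have key : ∀ z, polar F z ≤ r → ⟪z, ν⟫ = F ν * r → ∀ v, ⟪z, v⟫ = r * fderiv ℝ F ν v := by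
    intro z hz hzν v
    have hmin : IsLocalMin (fun ξ => r * F ξ - ⟪z, ξ⟫) ν := by
      refine Filter.Eventually.of_forall fun ξ => ?_
      simp only
      have := (hF.inner_le ξ z).trans (mul_le_mul_of_nonneg_left hz (hF.nonneg ξ))
      rw [real_inner_comm] at this
      linarith
    have hder : HasFDerivAt (fun ξ => r * F ξ - ⟪z, ξ⟫) (r • fderiv ℝ F ν - innerSL ℝ z) ν :=
      ((hF.differentiableAt hν).hasFDerivAt.const_mul _).sub (innerSL ℝ z).hasFDerivAt
    have := congrArg (fun L => L v) (hmin.hasFDerivAt_eq_zero hder)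
    simp only [sub_apply, smul_apply, smul_eq_mul, innerSL_apply_apply, zero_apply] at this
    linarith
  exact ext_inner_right ℝ fun v => by rw [key x hx hxν v, key y hy hyν v]

/-- Thin caps of the Wulff shape shrink to the touching point. -/
theorem exists_cap_subset (hF : IsFinslerNorm p F) {ν x : EuclideanSpace ℝ (Fin n)} (hν : ν ≠ 0)
    {r : ℝ} (hx : polar F x ≤ r) (hxν : ⟪x, ν⟫ = F ν * r) {η : ℝ} (hη : 0 < η) :
    ∃ ε > 0, ∀ z, polar F z ≤ r → F ν * r - ε ≤ ⟪z, ν⟫ → polar F (z - x) < η := by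
  have hcomp : IsCompact ({z | polar F z ≤ r} ∩ {z | η ≤ polar F (z - x)}) :=
    (hF.isCompact_polar_le r).inter_right (isClosed_le continuous_const
      (hF.continuous_polar.comp (by fun_prop)))
  rcases ({z | polar F z ≤ r} ∩ {z | η ≤ polar F (z - x)}).eq_empty_or_nonempty with h | h
  · refine ⟨1, one_pos, fun z hz _ => ?_⟩
    by_contra! hzη
    exact (h ▸ (⟨hz, hzη⟩ : z ∈ {z | polar F z ≤ r} ∩ {z | η ≤ polar F (z - x)}) :
      z ∈ (∅ : Set _))
  · obtain ⟨w, ⟨hw, hwη⟩, hmax⟩ := hcomp.exists_isMaxOn h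
      (f := fun z => ⟪z, ν⟫) (by fun_prop)
    have hlt : ⟪w, ν⟫ < F ν * r := by
      refine lt_of_le_of_ne ?_ fun heq => ?_
      · rw [real_inner_comm]
        exact (hF.inner_le ν w).trans (mul_le_mul_of_nonneg_left hw (hF.nonneg ν))
      · have := hF.eq_of_inner_eq hν hw hx heq hxν
        rw [this, mem_ofPred_eq, sub_self, hF.polar_zero] at hwη
        linarith
    refine ⟨(F ν * r - ⟪w, ν⟫) / 2, by linarith, fun z hz hzν => ?_⟩
    by_contra! hzη
    have : ⟪z, ν⟫ ≤ ⟪w, ν⟫ := hmax ⟨hz, hzη⟩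
    linarith

/-- Near a point `x` with `F°(x) = r`, the polar grows along `x / r` at a rate close to `1`. -/
theorem polar_add_smul_ge (hF : IsFinslerNorm p F) {x z : EuclideanSpace ℝ (Fin n)} {r η t : ℝ}
    (hr : 0 < r) (hx : polar F x = r) (hz : polar F (z - x) ≤ η) (ht : 0 ≤ t) :
    polar F z + t * (1 - 2 * η / r) ≤ polar F (z + t • r⁻¹ • x) := by
  have h1 : (r + t) • z = r • (z + t • r⁻¹ • x) + t • (z - x) := by
    match_scalars <;> field_simp
    ring
  have h2 := hF.polar_add_le (r • (z + t • r⁻¹ • x)) (t • (z - x))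
  rw [← h1, hF.polar_smul, hF.polar_smul, hF.polar_smul, abs_of_pos hr, abs_of_nonneg ht,
    abs_of_nonneg (by positivity)] at h2
  have h3 := hF.polar_add_le z (x - z)
  rw [add_sub_cancel, hx, ← neg_sub, hF.polar_neg] at h3
  have h4 : r * (polar F z + t * (1 - 2 * η / r)) ≤ r * polar F (z + t • r⁻¹ • x) := by
    have : r * (polar F z + t * (1 - 2 * η / r)) = r * polar F z + t * (r - 2 * η) := by
      field_simp
    rw [this]
    nlinarith [mul_le_mul_of_nonneg_left hz ht, mul_le_mul_of_nonneg_left h3 ht]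
  exact le_of_mul_le_mul_left h4 hr

theorem polar_ge_sub (hF : IsFinslerNorm p F) {x z : EuclideanSpace ℝ (Fin n)} {r η : ℝ}
    (hx : polar F x = r) (hz : polar F (z - x) ≤ η) : r - η ≤ polar F z := by
  have h3 := hF.polar_add_le z (x - z)
  rw [add_sub_cancel, hx, ← neg_sub, hF.polar_neg] at h3
  linarith

end IsFinslerNorm

/-- Bernoulli's inequality for real powers, in the form of a tangent line estimate. -/
theorem rpow_add_mul_le {a b q : ℝ} (hq : 1 ≤ q) (ha : 0 < a) (hab : a ≤ b) :
    a ^ q + q * a ^ (q - 1) * (b - a) ≤ b ^ q := by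
  have hba : 0 ≤ b / a := div_nonneg (ha.le.trans hab) ha.le
  have h := one_add_mul_self_le_rpow_one_add (s := b / a - 1) (by linarith) hq
  have h2 : b ^ q = a ^ q * (1 + (b / a - 1)) ^ q := by
    rw [← Real.mul_rpow ha.le (by linarith)]
    congr 1
    field_simp
    ring
  have h3 : a ^ q = a ^ (q - 1) * a := by
    rw [← Real.rpow_add_one ha.ne', sub_add_cancel]
  have h4 : a ^ q + q * a ^ (q - 1) * (b - a) = a ^ q * (1 + q * (b / a - 1)) := by
    rw [h3]
    field_simp
  rw [h4, h2]
  exact mul_le_mul_of_nonneg_left h (by positivity)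

/-! ### Weighted perimeters and their change under a hyperplane cut -/

/-- The anisotropic perimeter of `Ω` weighted by the density `w`. -/
def weightedPerimeter (F : EuclideanSpace ℝ (Fin n) → ℝ) (w : EuclideanSpace ℝ (Fin n) → ℝ)
    (Ω : Set (EuclideanSpace ℝ (Fin n))) : ℝ :=
  ∫ x in frontier Ω, w x * F (outerNormal Ω x) ∂μHE[n - 1]

theorem anisotropicPerimeter_eq_weightedPerimeter :
    anisotropicPerimeter F Ω = weightedPerimeter F (fun _ => 1) Ω := by
  simp [anisotropicPerimeter, weightedPerimeter]

theorem boundaryMomentum_eq_weightedPerimeter :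
    boundaryMomentum p F Ω = weightedPerimeter F (fun x => polar F x ^ p) Ω := rfl

theorem IsFinslerNorm.integrableOn_frontier (hF : IsFinslerNorm p F) (hΩ : IsAdmissible Ω)
    {w : EuclideanSpace ℝ (Fin n) → ℝ} (hw : Continuous w) :
    IntegrableOn (fun x => w x * F (outerNormal Ω x)) (frontier Ω) μHE[n - 1] := by
  have hm : MeasurableSet (frontier Ω) := isClosed_frontier.measurableSet
  have hmeas : Measurable fun x => w x * F ((smoothBoundary Ω).indicator (outerNormal Ω) x) :=
    hw.measurable.mul (hF.continuous.measurable.comp (measurable_indicator_outerNormal hΩ))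
  obtain ⟨C, hC0, hC⟩ := hF.exists_le_mul_norm
  obtain ⟨D, hD⟩ := hΩ.isCompact_frontier.exists_bound_of_continuousOn hw.continuousOn
  have hint : IntegrableOn (fun x => w x * F ((smoothBoundary Ω).indicator (outerNormal Ω) x))
      (frontier Ω) μHE[n - 1] := by
    refine Measure.integrableOn_of_bounded (M := D * C) hΩ.measure_frontier_lt_top.ne
      hmeas.aestronglyMeasurable ?_
    filter_upwards [ae_restrict_mem hm] with x hx
    rw [indicator_outerNormal_eq hx, norm_mul]
    have h1 : ‖F (outerNormal Ω x)‖ ≤ C := by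
      rw [Real.norm_eq_abs, abs_of_nonneg (hF.nonneg _)]
      refine (hC _).trans ?_
      have := norm_outerNormal_le (Ω := Ω) x
      nlinarith
    exact mul_le_mul (hD x hx) h1 (norm_nonneg _) ((norm_nonneg _).trans (hD x hx))
  refine hint.congr_fun (fun x hx => ?_) hm
  simp only
  rw [indicator_outerNormal_eq hx]

theorem IsFinslerNorm.weightedPerimeter_mono (hF : IsFinslerNorm p F) (hΩ : IsAdmissible Ω)
    {w w' : EuclideanSpace ℝ (Fin n) → ℝ} (hw : Continuous w) (hw' : Continuous w')
    (h : ∀ x ∈ frontier Ω, w x ≤ w' x) :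
    weightedPerimeter F w Ω ≤ weightedPerimeter F w' Ω :=
  setIntegral_mono_on (hF.integrableOn_frontier hΩ hw) (hF.integrableOn_frontier hΩ hw')
    isClosed_frontier.measurableSet fun x hx => mul_le_mul_of_nonneg_right (h x hx) (hF.nonneg _)

theorem IsFinslerNorm.weightedPerimeter_sub_const (hF : IsFinslerNorm p F) (hΩ : IsAdmissible Ω)
    {w : EuclideanSpace ℝ (Fin n) → ℝ} (hw : Continuous w) (θ : ℝ) :
    weightedPerimeter F (fun x => w x - θ) Ω =
      weightedPerimeter F w Ω - θ * anisotropicPerimeter F Ω := by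
  rw [anisotropicPerimeter_eq_weightedPerimeter, weightedPerimeter, weightedPerimeter,
    weightedPerimeter, ← integral_const_mul, ← integral_sub (hF.integrableOn_frontier hΩ hw)
      ((hF.integrableOn_frontier hΩ continuous_const).const_mul θ)]
  congr 1
  ext x
  ring

theorem weightedPerimeter_const (c : ℝ) :
    weightedPerimeter F (fun _ => c) Ω = c * anisotropicPerimeter F Ω := by
  rw [weightedPerimeter, integral_const_mul, anisotropicPerimeter]

theorem isOpen_setOf_inner_lt (ν : EuclideanSpace ℝ (Fin n)) (c : ℝ) :
    IsOpen {x : EuclideanSpace ℝ (Fin n) | ⟪x, ν⟫ < c} :=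
  isOpen_lt (by fun_prop) continuous_const

theorem IsAdmissible.inter_halfSpace (hΩ : IsAdmissible Ω) {ν : EuclideanSpace ℝ (Fin n)} {c : ℝ}
    (hne : (Ω ∩ {x | ⟪x, ν⟫ < c}).Nonempty) : IsAdmissible (Ω ∩ {x | ⟪x, ν⟫ < c}) where
  nonempty := hne
  isOpen := hΩ.isOpen.inter (isOpen_setOf_inner_lt ν c)
  isBounded := hΩ.isBounded.subset inter_subset_left
  convex := hΩ.convex.inter (convex_halfSpace_lt (isLinearMap_inner_left ν) c)

theorem mem_closure_setOf_inner_lt {ν x : EuclideanSpace ℝ (Fin n)} {c : ℝ} (hν : ‖ν‖ = 1)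
    (hx : ⟪x, ν⟫ = c) : x ∈ closure {x : EuclideanSpace ℝ (Fin n) | ⟪x, ν⟫ < c} := by
  have hlim : Filter.Tendsto (fun t : ℝ => x - t • ν) (𝓝[>] 0) (𝓝 x) := by
    have : Continuous fun t : ℝ => x - t • ν := by fun_prop
    have h := (this.tendsto 0).mono_left (nhdsWithin_le_nhds (s := Ioi 0))
    simpa using h
  refine mem_closure_of_tendsto hlim ?_
  filter_upwards [self_mem_nhdsWithin] with t ht
  have ht : 0 < t := ht
  simp only [inner_sub_left, inner_smul_left, conj_trivial,
    real_inner_self_eq_norm_sq, hν, hx]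
  linarith

theorem frontier_inter_halfSpace_subset (hΩ : IsOpen Ω) (ν : EuclideanSpace ℝ (Fin n)) (c : ℝ) :
    frontier (Ω ∩ {x | ⟪x, ν⟫ < c}) ⊆
      (frontier Ω ∩ {x | ⟪x, ν⟫ < c} ∪ {x ∈ Ω | ⟪x, ν⟫ = c}) ∪ frontier Ω ∩ {x | ⟪x, ν⟫ = c} := by
  intro x hx
  rw [(hΩ.inter (isOpen_setOf_inner_lt ν c)).frontier_eq] at hx
  have hxΩ : x ∈ closure Ω := closure_mono inter_subset_left hx.1
  have hxc : ⟪x, ν⟫ ≤ c := by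
    have : closure (Ω ∩ {x | ⟪x, ν⟫ < c}) ⊆ {x | ⟪x, ν⟫ ≤ c} :=
      closure_minimal (fun y hy => le_of_lt (show ⟪y, ν⟫ < c from hy.2))
        (isClosed_le (by fun_prop) continuous_const)
    exact this hx.1
  by_cases hmem : x ∈ Ω
  · refine Or.inl (Or.inr ⟨hmem, le_antisymm hxc ?_⟩)
    by_contra! hlt
    exact hx.2 ⟨hmem, hlt⟩
  · have hf : x ∈ frontier Ω := by
      rw [hΩ.frontier_eq]
      exact ⟨hxΩ, hmem⟩
    rcases hxc.lt_or_eq with h | h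
    · exact Or.inl (Or.inl ⟨hf, h⟩)
    · exact Or.inr ⟨hf, h⟩

theorem subset_frontier_inter_halfSpace (hΩ : IsOpen Ω) {ν : EuclideanSpace ℝ (Fin n)}
    (hν : ‖ν‖ = 1) (c : ℝ) :
    frontier Ω ∩ {x | ⟪x, ν⟫ < c} ∪ {x ∈ Ω | ⟪x, ν⟫ = c} ⊆ frontier (Ω ∩ {x | ⟪x, ν⟫ < c}) := by
  rw [(hΩ.inter (isOpen_setOf_inner_lt ν c)).frontier_eq]
  rintro x (⟨hx, hxc⟩ | ⟨hx, hxc⟩)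
  · rw [hΩ.frontier_eq] at hx
    refine ⟨?_, fun h => hx.2 h.1⟩
    rw [inter_comm]
    exact (isOpen_setOf_inner_lt ν c).inter_closure ⟨hxc, hx.1⟩
  · exact ⟨hΩ.inter_closure ⟨hx, mem_closure_setOf_inner_lt hν hxc⟩,
      fun h => h.2.ne hxc⟩

theorem outerNormal_congr {Ω' : Set (EuclideanSpace ℝ (Fin n))} {x : EuclideanSpace ℝ (Fin n)}
    (h : ∀ ν, IsOuterUnitNormal Ω' x ν ↔ IsOuterUnitNormal Ω x ν) :
    outerNormal Ω' x = outerNormal Ω x := by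
  have : IsOuterUnitNormal Ω' x = IsOuterUnitNormal Ω x := funext fun ν => propext (h ν)
  by_cases hu : ∃! ν, IsOuterUnitNormal Ω x ν
  · have hu' : ∃! ν, IsOuterUnitNormal Ω' x ν := by rwa [this]
    rw [outerNormal, outerNormal, dif_pos hu, dif_pos hu']
    exact hu.unique ((h _).1 hu'.choose_spec.1) hu.choose_spec.1
  · rw [outerNormal_eq_zero hu, outerNormal_eq_zero (by rwa [this])]

/-- Outer normals of convex sets are determined locally. -/
theorem outerNormal_inter_halfSpace (hΩ : IsAdmissible Ω) {ν x : EuclideanSpace ℝ (Fin n)} {c : ℝ}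
    (hx : x ∈ frontier Ω) (hxc : ⟪x, ν⟫ < c) :
    outerNormal (Ω ∩ {x | ⟪x, ν⟫ < c}) x = outerNormal Ω x := by
  refine outerNormal_congr fun ν' => ⟨fun h => ⟨h.1, fun y hy => ?_⟩,
    fun h => ⟨h.1, fun y hy => h.2 y hy.1⟩⟩
  have hcont : Continuous fun t : ℝ => x + t • (y - x) := by fun_prop
  have hev : ∀ᶠ t in 𝓝[>] (0 : ℝ), x + t • (y - x) ∈ {x | ⟪x, ν⟫ < c} :=
    nhdsWithin_le_nhds (hcont.continuousAt.eventually_mem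
      ((isOpen_setOf_inner_lt ν c).mem_nhds (by simpa using hxc)))
  obtain ⟨t, ht, ht0, ht1⟩ := (hev.and (Ioo_mem_nhdsGT (zero_lt_one' ℝ))).exists
  have hmem : x + t • (y - x) ∈ Ω := by
    have := hΩ.convex.add_smul_sub_mem_interior' (frontier_subset_closure hx)
      (by rwa [hΩ.isOpen.interior_eq]) ⟨ht0, ht1.le⟩
    rwa [hΩ.isOpen.interior_eq] at this
  have h1 := h.2 _ ⟨hmem, ht⟩
  rw [add_sub_cancel_left, inner_smul_left, conj_trivial] at h1
  exact nonpos_of_mul_nonpos_right h1 ht0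

theorem outerNormal_of_mem_face (hΩ : IsOpen Ω) {ν x : EuclideanSpace ℝ (Fin n)} {c : ℝ}
    (hν : ‖ν‖ = 1) (hx : x ∈ Ω) (hxc : ⟪x, ν⟫ = c) :
    outerNormal (Ω ∩ {x | ⟪x, ν⟫ < c}) x = ν := by
  have hνν : ⟪ν, ν⟫ = (1 : ℝ) := by rw [real_inner_self_eq_norm_sq, hν, one_pow]
  have hmem : IsOuterUnitNormal (Ω ∩ {x | ⟪x, ν⟫ < c}) x ν := by
    refine ⟨hν, fun y hy => ?_⟩
    have : ⟪y, ν⟫ < c := hy.2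
    rw [inner_sub_left]
    linarith
  refine (IsOuterUnitNormal.eq_outerNormal hmem
    ⟨subset_frontier_inter_halfSpace hΩ hν c (Or.inr ⟨hx, hxc⟩), ν, hmem, fun ν' hν' => ?_⟩).symm
  -- a unit normal `ν'` is tested with the direction `ν' - b ν`, where `b > ⟪ν', ν⟫` tends to it
  have hdir : ∀ b : ℝ, ⟪ν', ν⟫ < b → 1 ≤ b * ⟪ν', ν⟫ := by
    intro b hb
    have hcont : Continuous fun t : ℝ => x + t • (ν' - b • ν) := by fun_prop
    have hev : ∀ᶠ t in 𝓝[>] (0 : ℝ), x + t • (ν' - b • ν) ∈ Ω :=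
      nhdsWithin_le_nhds (hcont.continuousAt.eventually_mem (hΩ.mem_nhds (by simpa using hx)))
    obtain ⟨t, ht, ht0⟩ := (hev.and self_mem_nhdsWithin).exists
    have ht0 : 0 < t := ht0
    have h1 := hν'.2 (x + t • (ν' - b • ν)) ⟨ht, by
      simp only [mem_ofPred_eq, inner_add_left, inner_smul_left, inner_sub_left, conj_trivial, hνν,
        hxc]
      nlinarith⟩
    rw [add_sub_cancel_left, inner_smul_left, inner_sub_left, inner_smul_left, conj_trivial,
      conj_trivial, real_inner_self_eq_norm_sq, hν'.1, real_inner_comm] at h1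
    have := nonpos_of_mul_nonpos_right h1 ht0
    linarith
  have hsq : 1 ≤ ⟪ν', ν⟫ * ⟪ν', ν⟫ := by
    have hlim : Filter.Tendsto (fun b : ℝ => b * ⟪ν', ν⟫) (𝓝[>] ⟪ν', ν⟫)
        (𝓝 (⟪ν', ν⟫ * ⟪ν', ν⟫)) :=
      (Filter.tendsto_id.mono_left nhdsWithin_le_nhds).mul_const _
    refine ge_of_tendsto hlim ?_
    filter_upwards [self_mem_nhdsWithin] with b hb using hdir b hb
  have habs : |⟪ν', ν⟫| ≤ 1 := by
    simpa [hν, hν'.1] using abs_real_inner_le_norm ν' ν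
  have hone : ⟪ν', ν⟫ = 1 := by
    have h1 := hdir (⟪ν', ν⟫ + 2) (by linarith)
    nlinarith [abs_le.1 habs]
  exact (inner_eq_one_iff_of_norm_eq_one hν'.1 hν).1 hone

/-- Cutting `Ω` along `{⟪·, ν⟫ = c}` trades the boundary of the removed cap for the flat face. -/
theorem IsFinslerNorm.weightedPerimeter_inter_halfSpace (hF : IsFinslerNorm p F)
    (hΩ : IsAdmissible Ω) {ν : EuclideanSpace ℝ (Fin n)} {c : ℝ} (hν : ‖ν‖ = 1)
    (hne : (Ω ∩ {x | ⟪x, ν⟫ < c}).Nonempty)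
    (hnull : μHE[n - 1] (frontier Ω ∩ {x | ⟪x, ν⟫ = c}) = 0)
    {w : EuclideanSpace ℝ (Fin n) → ℝ} (hw : Continuous w) :
    weightedPerimeter F w Ω - weightedPerimeter F w (Ω ∩ {x | ⟪x, ν⟫ < c}) =
      (∫ x in frontier Ω ∩ {x | c < ⟪x, ν⟫}, w x * F (outerNormal Ω x) ∂μHE[n - 1]) -
        F ν * ∫ y in {y ∈ Ω | ⟪y, ν⟫ = c}, w y ∂μHE[n - 1] := by
  set Ω' := Ω ∩ {x | ⟪x, ν⟫ < c} with hΩ'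
  have hadm : IsAdmissible Ω' := hΩ.inter_halfSpace hne
  have hfm : MeasurableSet (frontier Ω) := isClosed_frontier.measurableSet
  have hlm : MeasurableSet (frontier Ω ∩ {x | ⟪x, ν⟫ < c}) :=
    hfm.inter (isOpen_setOf_inner_lt ν c).measurableSet
  have hgm : MeasurableSet (frontier Ω ∩ {x | c < ⟪x, ν⟫}) :=
    hfm.inter (isOpen_setOf_lt_inner ν c).measurableSet
  have hTm : MeasurableSet {y ∈ Ω | ⟪y, ν⟫ = c} :=
    hΩ.isOpen.measurableSet.inter (measurableSet_setOf_inner_eq ν c)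
  have hint := hF.integrableOn_frontier hΩ hw
  have hint' := hF.integrableOn_frontier hadm hw
  have e1 : weightedPerimeter F w Ω =
      (∫ x in frontier Ω ∩ {x | ⟪x, ν⟫ < c}, w x * F (outerNormal Ω x) ∂μHE[n - 1]) +
      ∫ x in frontier Ω ∩ {x | c < ⟪x, ν⟫}, w x * F (outerNormal Ω x) ∂μHE[n - 1] := by
    rw [weightedPerimeter, ← setIntegral_union ?_ hgm (hint.mono_set inter_subset_left)
      (hint.mono_set inter_subset_left)]
    · refine setIntegral_congr_set ?_
      refine (Filter.EventuallyLE.antisymm ?_ ?_)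
      · refine (ae_le_set.2 (measure_mono_null ?_ hnull))
        rintro x ⟨hx, hx'⟩
        refine ⟨hx, ?_⟩
        by_contra hne'
        rcases lt_or_gt_of_ne hne' with h | h
        · exact hx' (Or.inl ⟨hx, h⟩)
        · exact hx' (Or.inr ⟨hx, h⟩)
      · exact (union_subset inter_subset_left inter_subset_left).eventuallyLE
    · rw [disjoint_left]
      rintro x ⟨-, h1⟩ ⟨-, h2⟩
      exact lt_asymm (show ⟪x, ν⟫ < c from h1) h2
  have e2 : weightedPerimeter F w Ω' =
      (∫ x in frontier Ω ∩ {x | ⟪x, ν⟫ < c}, w x * F (outerNormal Ω x) ∂μHE[n - 1]) +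
      F ν * ∫ y in {y ∈ Ω | ⟪y, ν⟫ = c}, w y ∂μHE[n - 1] := by
    have hsub := subset_frontier_inter_halfSpace hΩ.isOpen hν c
    have h1 : weightedPerimeter F w Ω' = ∫ x in frontier Ω ∩ {x | ⟪x, ν⟫ < c} ∪
        {x ∈ Ω | ⟪x, ν⟫ = c}, w x * F (outerNormal Ω' x) ∂μHE[n - 1] := by
      refine setIntegral_congr_set (Filter.EventuallyLE.antisymm ?_ hsub.eventuallyLE)
      refine ae_le_set.2 (measure_mono_null ?_ hnull)
      rintro x ⟨hx, hx'⟩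
      exact (frontier_inter_halfSpace_subset hΩ.isOpen ν c hx).resolve_left hx'
    rw [h1, setIntegral_union ?_ hTm (hint'.mono_set (subset_union_left.trans hsub))
      (hint'.mono_set (subset_union_right.trans hsub)), ← integral_const_mul]
    · congr 1
      · refine setIntegral_congr_fun hlm fun x hx => ?_
        rw [outerNormal_inter_halfSpace hΩ hx.1 hx.2]
      · refine setIntegral_congr_fun hTm fun x hx => ?_
        rw [outerNormal_of_mem_face hΩ.isOpen hν hx.1 hx.2, mul_comm]
    · rw [disjoint_left]
      rintro x ⟨-, h1⟩ ⟨-, h2⟩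
      exact (show ⟪x, ν⟫ < c from h1).ne h2
  rw [e1, e2]
  ring

/-! ### Gain from cutting off a thin cap -/

theorem vol_nonneg (Ω : Set (EuclideanSpace ℝ (Fin n))) : 0 ≤ vol Ω :=
  ENNReal.toReal_nonneg

theorem IsAdmissible.vol_pos (hΩ : IsAdmissible Ω) : 0 < vol Ω :=
  ENNReal.toReal_pos (hΩ.isOpen.measure_pos volume hΩ.nonempty).ne' hΩ.isBounded.measure_lt_top.ne

/-- The perimeter is positive: the whole set is swept out by its boundary along a long vector. -/
theorem IsFinslerNorm.anisotropicPerimeter_pos (hF : IsFinslerNorm p F) (hn : n ≠ 0)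
    (hΩ : IsAdmissible Ω) : 0 < anisotropicPerimeter F Ω := by
  obtain ⟨ν, hν, -⟩ := hF.exists_inner_eq hn 0
  have hνν : ⟪ν, ν⟫ = (1 : ℝ) := by rw [real_inner_self_eq_norm_sq, hν, one_pow]
  obtain ⟨R, hR0, hR⟩ := hΩ.isBounded.subset_closedBall_lt 0 0
  have hRn : ∀ z ∈ Ω, |⟪z, ν⟫| ≤ R := fun z hz => by
    refine (abs_real_inner_le_norm z ν).trans ?_
    rw [hν, mul_one]
    exact mem_closedBall_zero_iff.1 (hR hz)
  have h := lintegral_exit_le hΩ (ν := ν) (ζ := ν) (by rw [hνν]; exact one_pos) (-R - 1)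
    (g := fun _ => 1) continuous_const (fun _ _ _ => zero_le_one) (fun _ _ _ _ _ _ => le_rfl)
    (τ := 3 * R) (by positivity)
  have hset : {z ∈ Ω | -R - 1 < ⟪z, ν⟫ ∧ z + (3 * R) • ν ∉ Ω} = Ω := by
    ext z
    refine ⟨fun hz => hz.1, fun hz => ⟨hz, by linarith [(abs_le.1 (hRn z hz)).1], fun hz' => ?_⟩⟩
    have h1 := (abs_le.1 (hRn _ hz')).2
    rw [inner_add_left, inner_smul_left, hνν, conj_trivial] at h1
    linarith [(abs_le.1 (hRn z hz)).1]
  rw [hset] at h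
  obtain ⟨a, ha, hle⟩ := hF.coercive
  have hint : Integrable (fun x => F (outerNormal Ω x)) (μHE[n - 1].restrict (frontier Ω)) := by
    have h1 := hF.integrableOn_frontier hΩ (continuous_const (y := (1 : ℝ)))
    simp only [one_mul] at h1
    exact h1
  refine lt_of_le_of_ne (integral_nonneg fun x => hF.nonneg _) fun hzero => ?_
  have hae := (integral_eq_zero_iff_of_nonneg (fun x => hF.nonneg _) hint).1 hzero.symm
  have hrhs : ∫⁻ x in frontier Ω ∩ {x | -R - 1 < ⟪x, ν⟫},
      ENNReal.ofReal |⟪ν, outerNormal Ω x⟫| * ENNReal.ofReal 1 ∂μHE[n - 1] = 0 := by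
    refine nonpos_iff_eq_zero.1 ((lintegral_mono_set inter_subset_left).trans_eq ?_)
    refine (lintegral_congr_ae ?_).trans lintegral_zero
    filter_upwards [hae] with x hx
    have h1 := hle (outerNormal Ω x)
    rw [hx, Pi.zero_apply] at h1
    have h2 : outerNormal Ω x = 0 := norm_le_zero_iff.1 (nonpos_of_mul_nonpos_right h1 ha)
    simp [h2]
  rw [hrhs, mul_zero, nonpos_iff_eq_zero] at h
  simp only [ENNReal.ofReal_one, lintegral_const, one_mul, Measure.restrict_apply_univ] at h
  exact (hΩ.isOpen.measure_pos volume hΩ.nonempty).ne' h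

/-- The one-sided divergence theorem on a cap, in terms of the anisotropic surface density. The
constant field `x / r` is a calibration: `⟪x / r, ·⟫ ≤ F`, with equality at `ν`. -/
theorem IsFinslerNorm.cap_integral_le (hF : IsFinslerNorm p F) (hΩ : IsAdmissible Ω)
    {x ν : EuclideanSpace ℝ (Fin n)} {r : ℝ} (hν : ‖ν‖ = 1) (hr : 0 < r) (hx : polar F x = r)
    (hxν : ⟪x, ν⟫ = F ν * r) (c : ℝ) {g : EuclideanSpace ℝ (Fin n) → ℝ} (hg : Continuous g)
    {κ : ℝ} (hκ : 0 ≤ κ) (hg0 : ∀ z ∈ closure Ω, c ≤ ⟪z, ν⟫ → 0 ≤ g z)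
    (hgmono : ∀ z ∈ Ω, c ≤ ⟪z, ν⟫ → ∀ t : ℝ, 0 ≤ t → z + t • r⁻¹ • x ∈ closure Ω →
      g z + κ * t ≤ g (z + t • r⁻¹ • x)) :
    κ * vol {z ∈ Ω | c < ⟪z, ν⟫} ≤
      (∫ x in frontier Ω ∩ {x | c < ⟪x, ν⟫}, g x * F (outerNormal Ω x) ∂μHE[n - 1]) -
        F ν * ∫ y in {y ∈ Ω | ⟪y, ν⟫ = c}, g y ∂μHE[n - 1] := by
  have hν0 : ν ≠ 0 := by
    rintro rfl
    simp at hν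
  have hζ : ⟪r⁻¹ • x, ν⟫ = F ν := by
    rw [inner_smul_left, hxν, conj_trivial]
    field_simp
  have hζF : ∀ ξ, |⟪r⁻¹ • x, ξ⟫| ≤ F ξ := fun ξ => by
    have := hF.abs_inner_le ξ (r⁻¹ • x)
    rwa [hF.polar_smul, hx, abs_of_pos (inv_pos.2 hr), inv_mul_cancel₀ hr.ne', mul_one,
      real_inner_comm] at this
  have hTm : MeasurableSet {y ∈ Ω | ⟪y, ν⟫ = c} :=
    hΩ.isOpen.measurableSet.inter (measurableSet_setOf_inner_eq ν c)
  have hSm : MeasurableSet (frontier Ω ∩ {x | c < ⟪x, ν⟫}) :=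
    isClosed_frontier.measurableSet.inter (isOpen_setOf_lt_inner ν c).measurableSet
  have hdiv := divergence_cap_le hΩ (ν := ν) (ζ := r⁻¹ • x) hν (by rw [hζ]; exact hF.pos hν0) c hg
    hκ hg0 hgmono
  rw [hζ] at hdiv
  have hTint : IntegrableOn g {y ∈ Ω | ⟪y, ν⟫ = c} μHE[n - 1] := by
    obtain ⟨D, hD⟩ := hΩ.isCompact_closure.exists_bound_of_continuousOn hg.continuousOn
    refine Measure.integrableOn_of_bounded (M := D)
      (euclideanHausdorffMeasure_lt_top_of_subset_hyperplane hν (fun y hy => hy.2)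
        (hΩ.isBounded.subset fun y hy => hy.1)).ne hg.aestronglyMeasurable ?_
    filter_upwards [ae_restrict_mem hTm] with y hy using hD y (subset_closure hy.1)
  have hSint : IntegrableOn (fun x => g x * F (outerNormal Ω x))
      (frontier Ω ∩ {x | c < ⟪x, ν⟫}) μHE[n - 1] :=
    (hF.integrableOn_frontier hΩ hg).mono_set inter_subset_left
  have hT0 : 0 ≤ᵐ[μHE[n - 1].restrict {y ∈ Ω | ⟪y, ν⟫ = c}] g :=
    ae_restrict_of_forall_mem hTm fun y hy => hg0 y (subset_closure hy.1) hy.2.ge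
  have hS0 : 0 ≤ᵐ[μHE[n - 1].restrict (frontier Ω ∩ {x | c < ⟪x, ν⟫})]
      fun x => g x * F (outerNormal Ω x) :=
    ae_restrict_of_forall_mem hSm fun y hy => mul_nonneg
      (hg0 y (frontier_subset_closure hy.1) (le_of_lt hy.2)) (hF.nonneg _)
  have hA : volume {z ∈ Ω | c < ⟪z, ν⟫} = ENNReal.ofReal (vol {z ∈ Ω | c < ⟪z, ν⟫}) :=
    (ENNReal.ofReal_toReal (hΩ.isBounded.subset fun y hy => hy.1).measure_lt_top.ne).symm
  have hle : ∫⁻ x' in frontier Ω ∩ {x | c < ⟪x, ν⟫},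
      ENNReal.ofReal |⟪r⁻¹ • x, outerNormal Ω x'⟫| * ENNReal.ofReal (g x') ∂μHE[n - 1] ≤
      ENNReal.ofReal (∫ x in frontier Ω ∩ {x | c < ⟪x, ν⟫},
        g x * F (outerNormal Ω x) ∂μHE[n - 1]) := by
    rw [ofReal_integral_eq_lintegral_ofReal hSint hS0]
    refine setLIntegral_mono' hSm fun y hy => ?_
    rw [← ENNReal.ofReal_mul (abs_nonneg _), mul_comm (g y)]
    exact ENNReal.ofReal_le_ofReal (mul_le_mul_of_nonneg_right (hζF _)
      (hg0 y (frontier_subset_closure hy.1) (le_of_lt hy.2)))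
  have hfin := hdiv.trans hle
  rw [← ofReal_integral_eq_lintegral_ofReal hTint hT0, hA, ← ENNReal.ofReal_mul (hF.nonneg _),
    ← ENNReal.ofReal_mul hκ, ← ENNReal.ofReal_add (mul_nonneg (hF.nonneg _)
      (integral_nonneg_of_ae hT0)) (mul_nonneg hκ (vol_nonneg _)),
    ENNReal.ofReal_le_ofReal_iff (integral_nonneg_of_ae hS0)] at hfin
  linarith

/-- Lower bound for the growth rate of `(F°) ^ p` along `x / r`, at points `z` with
`F°(z - x) ≤ η`, where `F°(x) = r`. -/
def growthRate (p r η : ℝ) : ℝ := p * (r - η) ^ (p - 1) * (1 - 2 * η / r)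

theorem growthRate_pos (hp : 1 < p) {r η : ℝ} (hr : 0 < r) (hη : η < r / 2) :
    0 < growthRate p r η := by
  have h1 : 0 < (r - η) ^ (p - 1) := Real.rpow_pos_of_pos (by linarith) _
  have h2 : 0 < 1 - 2 * η / r := by
    rw [sub_pos, div_lt_one hr]
    linarith
  unfold growthRate
  positivity

theorem tendsto_growthRate (p : ℝ) {r : ℝ} (hr : 0 < r) :
    Filter.Tendsto (growthRate p r) (𝓝[>] 0) (𝓝 (p * r ^ (p - 1))) := by
  have h : ContinuousAt (growthRate p r) 0 := by
    unfold growthRate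
    refine ContinuousAt.mul (continuousAt_const.mul (ContinuousAt.rpow_const (by fun_prop)
      (Or.inl (by simpa using hr.ne')))) (by fun_prop)
  have h0 : growthRate p r 0 = p * r ^ (p - 1) := by simp [growthRate]
  rw [← h0]
  exact h.tendsto.mono_left nhdsWithin_le_nhds

theorem IsFinslerNorm.polar_rpow_add_smul_ge (hF : IsFinslerNorm p F) (hp : 1 < p)
    {x z : EuclideanSpace ℝ (Fin n)} {r η t : ℝ} (hr : 0 < r) (hη : η < r / 2)
    (hx : polar F x = r) (hz : polar F (z - x) ≤ η) (ht : 0 ≤ t) :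
    polar F z ^ p + growthRate p r η * t ≤ polar F (z + t • r⁻¹ • x) ^ p := by
  have h1 := hF.polar_ge_sub hx hz
  have h2 := hF.polar_add_smul_ge hr hx hz ht
  have h3 : 0 < 1 - 2 * η / r := by
    rw [sub_pos, div_lt_one hr]
    linarith
  have h4 : 0 < polar F z := by linarith
  have h5 := rpow_add_mul_le hp.le h4 (b := polar F (z + t • r⁻¹ • x))
    (by nlinarith [mul_nonneg ht h3.le])
  refine le_trans ?_ h5
  have h6 : (r - η) ^ (p - 1) ≤ polar F z ^ (p - 1) :=
    Real.rpow_le_rpow (by linarith) h1 (by linarith)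
  have h7 : growthRate p r η * t = p * (r - η) ^ (p - 1) * (t * (1 - 2 * η / r)) := by
    unfold growthRate
    ring
  rw [h7]
  have h8 : 0 ≤ (r - η) ^ (p - 1) := Real.rpow_nonneg (by linarith) _
  have h9 : 0 ≤ t * (1 - 2 * η / r) := mul_nonneg ht h3.le
  gcongr
  linarith

/-- The gain in the weighted perimeter from a cut, when the density `(F°) ^ p - θ` is nonnegative on
the cap. -/
theorem IsFinslerNorm.growthRate_mul_vol_le (hF : IsFinslerNorm p F) (hp : 1 < p)
    (hΩ : IsAdmissible Ω) {x ν : EuclideanSpace ℝ (Fin n)} {r η θ : ℝ} (hν : ‖ν‖ = 1) (hr : 0 < r)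
    (hx : polar F x = r) (hxν : ⟪x, ν⟫ = F ν * r) (hη : η < r / 2) (hθ : θ ≤ (r - η) ^ p)
    {c : ℝ} (hc : ∀ z ∈ closure Ω, c ≤ ⟪z, ν⟫ → polar F (z - x) < η) :
    growthRate p r η * vol {z ∈ Ω | c < ⟪z, ν⟫} ≤
      (∫ x in frontier Ω ∩ {x | c < ⟪x, ν⟫},
        (polar F x ^ p - θ) * F (outerNormal Ω x) ∂μHE[n - 1]) -
        F ν * ∫ y in {y ∈ Ω | ⟪y, ν⟫ = c}, (polar F y ^ p - θ) ∂μHE[n - 1] := by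
  refine hF.cap_integral_le hΩ hν hr hx hxν c (g := fun z => polar F z ^ p - θ) ?_
    (growthRate_pos hp hr hη).le ?_ ?_
  · exact (hF.continuous_polar.rpow_const fun _ => Or.inr (by linarith)).sub continuous_const
  · intro z hz hzc
    have h1 := hF.polar_ge_sub hx (hc z hz hzc).le
    have : (r - η) ^ p ≤ polar F z ^ p := Real.rpow_le_rpow (by linarith) h1 (by linarith)
    linarith
  · intro z hz hzc t ht _
    have := hF.polar_rpow_add_smul_ge hp hr hη hx (hc z (subset_closure hz) hzc).le ht
    linarith

theorem IsFinslerNorm.frontier_polar_lt_subset (hF : IsFinslerNorm p F) (r : ℝ) :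
    frontier {v | polar F v < r} ⊆ {v | polar F v = r} :=
  frontier_lt_subset_eq hF.continuous_polar continuous_const

/-- The gain in the weighted perimeter from a cut, when `Ω` is a Wulff shape of radius `r` and
`θ = r ^ p`. The density vanishes on the boundary of the cap, and the cap lies below the graph of a
multiple of `r ^ p - (F°) ^ p` over its flat face. -/
theorem IsFinslerNorm.growthRate_mul_vol_le_of_wulff (hF : IsFinslerNorm p F) (hp : 1 < p)
    {x ν : EuclideanSpace ℝ (Fin n)} {r η : ℝ} (hν : ‖ν‖ = 1) (hr : 0 < r)
    (hx : polar F x = r) (hxν : ⟪x, ν⟫ = F ν * r) (hη : η < r / 2) {c : ℝ} (hc0 : 0 ≤ c)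
    (hc : ∀ z, polar F z ≤ r → c ≤ ⟪z, ν⟫ → polar F (z - x) < η) :
    growthRate p r η * vol {z ∈ {v | polar F v < r} | c < ⟪z, ν⟫} ≤
      (∫ x in frontier {v | polar F v < r} ∩ {x | c < ⟪x, ν⟫},
        (polar F x ^ p - r ^ p) * F (outerNormal {v | polar F v < r} x) ∂μHE[n - 1]) -
        F ν * ∫ y in {y ∈ {v | polar F v < r} | ⟪y, ν⟫ = c},
          (polar F y ^ p - r ^ p) ∂μHE[n - 1] := by
  set Ω := {v | polar F v < r} with hΩdef
  have hΩ : IsAdmissible Ω := hF.isAdmissible_polar_lt hr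
  have hν0 : ν ≠ 0 := by
    rintro rfl
    simp at hν
  have hFν := hF.pos hν0
  have hκ := growthRate_pos hp hr hη
  have hζ : ⟪r⁻¹ • x, ν⟫ = F ν := by
    rw [inner_smul_left, hxν, conj_trivial]
    field_simp
  have hcont : Continuous fun y => polar F y ^ p :=
    hF.continuous_polar.rpow_const fun _ => Or.inr (by linarith)
  have hTm : MeasurableSet {y ∈ Ω | ⟪y, ν⟫ = c} :=
    hΩ.isOpen.measurableSet.inter (measurableSet_setOf_inner_eq ν c)
  have hS : ∫ x in frontier Ω ∩ {x | c < ⟪x, ν⟫},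
      (polar F x ^ p - r ^ p) * F (outerNormal Ω x) ∂μHE[n - 1] = 0 := by
    refine setIntegral_eq_zero_of_forall_eq_zero fun z hz => ?_
    have : polar F z = r := hF.frontier_polar_lt_subset r hz.1
    rw [this, sub_self, zero_mul]
  have hk0 : ∀ y ∈ {y ∈ Ω | ⟪y, ν⟫ = c}, 0 ≤ (r ^ p - polar F y ^ p) / growthRate p r η := by
    intro y hy
    have : polar F y ^ p ≤ r ^ p :=
      Real.rpow_le_rpow (hF.polar_nonneg y) (le_of_lt hy.1) (by linarith)
    exact div_nonneg (by linarith) hκ.le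
  have hvol := volume_subgraph hν (ζ := r⁻¹ • x) (by rw [hζ]; exact hFν) hTm (fun y hy => hy.2)
    (k := fun y => (r ^ p - polar F y ^ p) / growthRate p r η)
    ((continuous_const.sub hcont).div_const _).measurable hk0
  have hsub : {z ∈ Ω | c < ⟪z, ν⟫} ⊆ {z | ∃ y ∈ {y ∈ Ω | ⟪y, ν⟫ = c}, ∃ t, 0 < t ∧
      t ≤ (r ^ p - polar F y ^ p) / growthRate p r η ∧ z = y + t • r⁻¹ • x} := by
    rintro z ⟨hz, hzc⟩
    have hz : polar F z < r := hz
    set t := (⟪z, ν⟫ - c) / F ν with ht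
    have ht0 : 0 < t := div_pos (by linarith) hFν
    have htr : t ≤ r := by
      rw [ht, div_le_iff₀ hFν]
      have := hF.inner_le ν z
      rw [real_inner_comm] at this
      nlinarith
    have hyc : ⟪z - t • r⁻¹ • x, ν⟫ = c := by
      rw [inner_sub_left, inner_smul_left, hζ, conj_trivial, ht]
      field_simp
      ring
    -- the segment from `z` to `z - x` stays in the Wulff shape
    have hyΩ : polar F (z - t • r⁻¹ • x) < r := by
      have h1 : z - t • r⁻¹ • x = (1 - t / r) • z + (t / r) • (z - x) := by
        match_scalars <;> field_simp
        ring
      have htr' : t / r ≤ 1 := (div_le_one hr).2 htr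
      have htr0 : 0 < t / r := by positivity
      have h2 := hF.polar_add_le ((1 - t / r) • z) ((t / r) • (z - x))
      rw [← h1, hF.polar_smul, hF.polar_smul, abs_of_nonneg (by linarith),
        abs_of_pos htr0] at h2
      have h3 := hc z hz.le hzc.le
      nlinarith
    refine ⟨z - t • r⁻¹ • x, ⟨hyΩ, hyc⟩, t, ht0, ?_, by abel⟩
    have h4 := hF.polar_rpow_add_smul_ge hp hr hη hx (hc _ hyΩ.le hyc.ge).le ht0.le
    rw [sub_add_cancel] at h4
    have h5 : polar F z ^ p ≤ r ^ p :=
      Real.rpow_le_rpow (hF.polar_nonneg z) hz.le (by linarith)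
    rw [le_div_iff₀ hκ]
    linarith
  have hTint : IntegrableOn (fun y => (r ^ p - polar F y ^ p) / growthRate p r η)
      {y ∈ Ω | ⟪y, ν⟫ = c} μHE[n - 1] := by
    have hkc : Continuous fun y => (r ^ p - polar F y ^ p) / growthRate p r η :=
      (continuous_const.sub hcont).div_const _
    obtain ⟨D, hD⟩ := hΩ.isCompact_closure.exists_bound_of_continuousOn hkc.continuousOn
    refine Measure.integrableOn_of_bounded (M := D)
      (euclideanHausdorffMeasure_lt_top_of_subset_hyperplane hν (fun y hy => hy.2)
        (hΩ.isBounded.subset fun y hy => hy.1)).ne hkc.aestronglyMeasurable ?_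
    filter_upwards [ae_restrict_mem hTm] with y hy using hD y (subset_closure hy.1)
  have hT0 : 0 ≤ᵐ[μHE[n - 1].restrict {y ∈ Ω | ⟪y, ν⟫ = c}]
      fun y => (r ^ p - polar F y ^ p) / growthRate p r η := ae_restrict_of_forall_mem hTm hk0
  have hle := (measure_mono hsub).trans_eq hvol
  rw [← ofReal_integral_eq_lintegral_ofReal hTint hT0, hζ, ← ENNReal.ofReal_mul hFν.le] at hle
  have hle' := ENNReal.toReal_le_of_le_ofReal (mul_nonneg hFν.le (integral_nonneg_of_ae hT0)) hle
  have heq : ∫ y in {y ∈ Ω | ⟪y, ν⟫ = c}, (polar F y ^ p - r ^ p) ∂μHE[n - 1] =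
      -(growthRate p r η * ∫ y in {y ∈ Ω | ⟪y, ν⟫ = c},
        (r ^ p - polar F y ^ p) / growthRate p r η ∂μHE[n - 1]) := by
    rw [← integral_const_mul, ← integral_neg]
    congr 1
    ext y
    field_simp
    ring
  rw [hS, heq]
  have := mul_le_mul_of_nonneg_left hle' hκ.le
  have hvd : vol {z ∈ Ω | c < ⟪z, ν⟫} = (volume {z ∈ Ω | c < ⟪z, ν⟫}).toReal := rfl
  rw [hvd]
  linarith

/-! ### Comparison of the functionals -/

theorem IsFinslerNorm.exists_polar_eq_rMax (hF : IsFinslerNorm p F) (hΩ : IsAdmissible Ω) :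
    ∃ x ∈ closure Ω, polar F x = rMax F Ω ∧ ∀ z ∈ closure Ω, polar F z ≤ rMax F Ω := by
  obtain ⟨x, hx, hmax⟩ := hΩ.isCompact_closure.exists_isMaxOn hΩ.nonempty.closure
    hF.continuous_polar.continuousOn
  have hgreat : IsGreatest (polar F '' closure Ω) (polar F x) :=
    ⟨mem_image_of_mem _ hx, by rintro _ ⟨z, hz, rfl⟩; exact hmax hz⟩
  have hr : rMax F Ω = polar F x := hgreat.csSup_eq
  exact ⟨x, hx, hr.symm, fun z hz => hr ▸ hmax hz⟩

theorem IsFinslerNorm.rMax_pos (hF : IsFinslerNorm p F) (hn : n ≠ 0) (hΩ : IsAdmissible Ω) :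
    0 < rMax F Ω := by
  have : NeZero n := ⟨hn⟩
  obtain ⟨-, -, -, hle⟩ := hF.exists_polar_eq_rMax hΩ
  obtain ⟨y, hy, hy0⟩ := (dense_compl_singleton (0 : EuclideanSpace ℝ (Fin n))).inter_open_nonempty
    Ω hΩ.isOpen hΩ.nonempty
  exact (hF.polar_pos hy0).trans_le (hle y (subset_closure hy))

/-- A cut at a level arbitrarily close to the top can avoid charging its hyperplane: all but
countably many parallel hyperplanes meet the boundary in a null set. -/
theorem IsAdmissible.exists_level (hΩ : IsAdmissible Ω) {ν x : EuclideanSpace ℝ (Fin n)}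
    (hν : ‖ν‖ = 1) (hmax : ∀ z ∈ Ω, ⟪z, ν⟫ ≤ ⟪x, ν⟫) {b : ℝ} (hb : b < ⟪x, ν⟫) :
    ∃ c, b < c ∧ c < ⟪x, ν⟫ ∧ μHE[n - 1] (frontier Ω ∩ {x | ⟪x, ν⟫ = c}) = 0 ∧
      (Ω ∩ {x | ⟪x, ν⟫ < c}).Nonempty := by
  obtain ⟨y, hy⟩ := hΩ.nonempty
  have hlt : ∃ z ∈ Ω, ⟪z, ν⟫ < ⟪x, ν⟫ := by
    obtain ⟨z, hz, hz'⟩ := mem_closure_iff.1 (mem_closure_setOf_inner_lt (c := ⟪y, ν⟫) hν rfl) Ω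
      hΩ.isOpen hy
    exact ⟨z, hz, (show ⟪z, ν⟫ < ⟪y, ν⟫ from hz').trans_le (hmax y hy)⟩
  obtain ⟨z, hz, hzx⟩ := hlt
  have hfin : IsFiniteMeasure (μHE[n - 1].restrict (frontier Ω)) :=
    ⟨by rw [Measure.restrict_apply_univ]; exact hΩ.measure_frontier_lt_top⟩
  have hcount := Measure.countable_meas_level_set_pos (μ := μHE[n - 1].restrict (frontier Ω))
    (g := fun x : EuclideanSpace ℝ (Fin n) => ⟪x, ν⟫) (by fun_prop)
  obtain ⟨c, hc, hc1, hc2⟩ := (hcount.dense_compl ℝ).exists_between (max_lt hb hzx)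
  refine ⟨c, (le_max_left _ _).trans_lt hc1, hc2, ?_, z, hz, (le_max_right _ _).trans_lt hc1⟩
  rw [mem_compl_iff, mem_ofPred_eq, not_lt, nonpos_iff_eq_zero,
    Measure.restrict_apply (measurableSet_setOf_inner_eq ν c), inter_comm] at hc
  exact hc

theorem eventually_one_sub_mul_le_rpow {q q' : ℝ} (hq : q < q') :
    ∀ᶠ u in 𝓝[>] (0 : ℝ), 1 - q' * u ≤ (1 - u) ^ q := by
  have hd : HasDerivAt (fun u : ℝ => (1 - u) ^ q + q' * u) (-q + q') 0 := by
    have h1 : HasDerivAt (fun u : ℝ => 1 - u) (-1) 0 := (hasDerivAt_id 0).const_sub 1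
    have h2 := h1.rpow_const (p := q) (Or.inl (by norm_num))
    have h3 : HasDerivAt (fun u : ℝ => (1 - u) ^ q + q' * u) _ 0 :=
      h2.add ((hasDerivAt_id (0 : ℝ)).const_mul q')
    convert h3 using 1
    simp
  have hev := (hasDerivAt_iff_tendsto_slope.1 hd).eventually (lt_mem_nhds (show (0 : ℝ) < -q + q' by
    linarith))
  have hev' : ∀ᶠ u in 𝓝[>] (0 : ℝ), 0 < slope (fun u : ℝ => (1 - u) ^ q + q' * u) 0 u :=
    hev.filter_mono (nhdsWithin_mono _ fun u hu => (ne_of_gt hu))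
  filter_upwards [hev', self_mem_nhdsWithin] with u hu hu0
  have hu0 : 0 < u := hu0
  rw [slope_def_field] at hu
  simp only [sub_zero, Real.one_rpow, mul_zero, add_zero] at hu
  have := (div_pos_iff_of_pos_right hu0).1 hu
  linarith

theorem exists_vol_lt (x : EuclideanSpace ℝ (Fin n)) (hn : n ≠ 0) {δ : ℝ} (hδ : 0 < δ) :
    ∃ ρ > 0, ∀ A ⊆ Metric.ball x ρ, vol A < δ := by
  have : NeZero n := ⟨hn⟩
  obtain ⟨U, hxU, hU, hUδ⟩ := ({x} : Set (EuclideanSpace ℝ (Fin n))).exists_isOpen_lt_of_lt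
    (μ := volume) (ENNReal.ofReal δ) (by simpa using hδ)
  obtain ⟨ρ, hρ, hball⟩ := Metric.isOpen_iff.1 hU x (hxU rfl)
  refine ⟨ρ, hρ, fun A hA => ?_⟩
  have h1 : volume A < ENNReal.ofReal δ := (measure_mono (hA.trans hball)).trans_lt hUδ
  exact (ENNReal.lt_ofReal_iff_toReal_lt h1.ne_top).1 h1

theorem vol_inter_halfSpace_add (hΩ : IsAdmissible Ω) {ν : EuclideanSpace ℝ (Fin n)}
    (hν : ‖ν‖ = 1) (c : ℝ) :
    vol (Ω ∩ {x | ⟪x, ν⟫ < c}) + vol {z ∈ Ω | c < ⟪z, ν⟫} = vol Ω := by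
  have hplane : volume {x : EuclideanSpace ℝ (Fin n) | ⟪x, ν⟫ = c} = 0 := by
    have hconv : Convex ℝ {x : EuclideanSpace ℝ (Fin n) | ⟪x, ν⟫ < c} :=
      convex_halfSpace_lt (isLinearMap_inner_left ν) c
    refine measure_mono_null (fun x hx => ?_) (hconv.addHaar_frontier volume)
    rw [(isOpen_setOf_inner_lt ν c).frontier_eq]
    exact ⟨mem_closure_setOf_inner_lt hν hx, fun h => (show ⟪x, ν⟫ < c from h).ne hx⟩
  have hfin : ∀ A ⊆ Ω, volume A ≠ ⊤ := fun A hA => (hΩ.isBounded.subset hA).measure_lt_top.ne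
  have hdisj : Disjoint (Ω ∩ {x | ⟪x, ν⟫ < c}) {z ∈ Ω | c < ⟪z, ν⟫} :=
    disjoint_left.2 fun x hx hx' => lt_asymm (show ⟪x, ν⟫ < c from hx.2) hx'.2
  have hmeas : MeasurableSet {z ∈ Ω | c < ⟪z, ν⟫} :=
    hΩ.isOpen.measurableSet.inter (isOpen_setOf_lt_inner ν c).measurableSet
  rw [vol, vol, vol, ← measureReal_union hdisj hmeas (hfin _ inter_subset_left)
    (hfin _ fun x hx => hx.1)]
  refine measureReal_congr (Filter.EventuallyLE.antisymm ?_ ?_)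
  · exact (union_subset inter_subset_left fun x hx => hx.1).eventuallyLE
  · refine ae_le_set.2 (measure_mono_null ?_ hplane)
    rintro x ⟨hx, hx'⟩
    by_contra hne
    rcases lt_or_gt_of_ne hne with h | h
    · exact hx' (Or.inl ⟨hx, h⟩)
    · exact hx' (Or.inr ⟨hx, h⟩)

/-- If small cuts near a farthest point gain at the rate `growthRate` per removed volume, then a
positive excess makes some cut decrease the functional: to first order the cut changes `M - θ P`
by at most `- p r ^ (p - 1)` times the removed volume, and `V ^ (p / n)` by a relative amount of
`p / (n V)` times the removed volume. -/
theorem IsFinslerNorm.exists_functionalF_lt_of_cap (hF : IsFinslerNorm p F) (hp : 1 < p)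
    (hn : n ≠ 0) (hΩ : IsAdmissible Ω) (hE : 0 < excess p F Ω)
    {x ν : EuclideanSpace ℝ (Fin n)} (hν : ‖ν‖ = 1) (hxΩ : x ∈ closure Ω)
    (hx : polar F x = rMax F Ω) (hmax : ∀ z ∈ closure Ω, polar F z ≤ rMax F Ω)
    (hxν : ⟪x, ν⟫ = F ν * rMax F Ω)
    (hcap : ∀ᶠ η in 𝓝[>] (0 : ℝ), ∀ c, 0 ≤ c →
      (∀ z, polar F z ≤ rMax F Ω → c ≤ ⟪z, ν⟫ → polar F (z - x) < η) →
      growthRate p (rMax F Ω) η * vol {z ∈ Ω | c < ⟪z, ν⟫} ≤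
        (∫ x in frontier Ω ∩ {x | c < ⟪x, ν⟫},
          (polar F x ^ p - boundaryMomentum p F Ω / anisotropicPerimeter F Ω) *
            F (outerNormal Ω x) ∂μHE[n - 1]) -
          F ν * ∫ y in {y ∈ Ω | ⟪y, ν⟫ = c},
            (polar F y ^ p - boundaryMomentum p F Ω / anisotropicPerimeter F Ω) ∂μHE[n - 1]) :
    ∃ Ω', IsAdmissible Ω' ∧ functionalF p F Ω' < functionalF p F Ω := by
  set r := rMax F Ω with hr_def
  set M := boundaryMomentum p F Ω with hM
  set P := anisotropicPerimeter F Ω with hP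
  set V := vol Ω with hV
  set θ := M / P with hθ
  have hr : 0 < r := hF.rMax_pos hn hΩ
  have hP0 : 0 < P := hF.anisotropicPerimeter_pos hn hΩ
  have hV0 : 0 < V := hΩ.vol_pos
  have hn0 : (0 : ℝ) < n := by exact_mod_cast Nat.pos_of_ne_zero hn
  have hM0 : 0 ≤ M := integral_nonneg fun y =>
    mul_nonneg (Real.rpow_nonneg (hF.polar_nonneg y) _) (hF.nonneg _)
  have hν0 : ν ≠ 0 := by
    rintro rfl
    simp at hν
  have hFν := hF.pos hν0
  have hwc : Continuous fun y => polar F y ^ p :=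
    hF.continuous_polar.rpow_const fun _ => Or.inr (by linarith)
  -- an exponent `q'` slightly above `p / n` that still leaves room in the excess inequality
  have hrate : p / n * (M / V) < p * r ^ (p - 1) := by
    have h1 : M / (n * V) < r ^ (p - 1) := by
      have := hE
      unfold excess at this
      linarith
    calc p / n * (M / V) = p * (M / (n * V)) := by field_simp
      _ < p * r ^ (p - 1) := by gcongr
  obtain ⟨q', hq', hq'rate⟩ : ∃ q', p / n < q' ∧ q' * (M / V) < p * r ^ (p - 1) := by
    have hcont : Continuous fun q : ℝ => q * (M / V) := by fun_prop
    have hev : ∀ᶠ q in 𝓝[>] (p / n : ℝ), q * (M / V) < p * r ^ (p - 1) :=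
      nhdsWithin_le_nhds ((hcont.tendsto _).eventually (gt_mem_nhds hrate))
    obtain ⟨q', h1, h2⟩ := (hev.and self_mem_nhdsWithin).exists
    exact ⟨q', h2, h1⟩
  obtain ⟨u₀, hu₀, hbern⟩ := mem_nhdsGT_iff_exists_Ioo_subset.1
    (eventually_one_sub_mul_le_rpow hq')
  have hu₀ : 0 < u₀ := hu₀
  obtain ⟨ρ, hρ, hρvol⟩ := exists_vol_lt x hn (mul_pos hu₀ hV0)
  obtain ⟨C, hC, hnorm⟩ := hF.exists_norm_le_mul_polar
  have hev_pos : ∀ᶠ η in 𝓝[>] (0 : ℝ), 0 < η := self_mem_nhdsWithin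
  have hev_lt : ∀ ε : ℝ, 0 < ε → ∀ᶠ η in 𝓝[>] (0 : ℝ), η < ε := fun ε hε =>
    nhdsWithin_le_nhds (gt_mem_nhds hε)
  obtain ⟨η, hηcap, hηrate, hη0, hηr, hηρ⟩ := (hcap.and (((tendsto_growthRate p hr).eventually
    (lt_mem_nhds hq'rate)).and (hev_pos.and ((hev_lt _ (half_pos hr)).and
    (hev_lt _ (div_pos hρ hC)))))).exists
  have hκ : 0 < growthRate p r η := growthRate_pos hp hr hηr
  obtain ⟨ε, hε, hεcap⟩ := hF.exists_cap_subset hν0 hx.le hxν hη0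
  have hmaxν : ∀ z ∈ Ω, ⟪z, ν⟫ ≤ ⟪x, ν⟫ := fun z hz => by
    rw [hxν, real_inner_comm]
    exact (hF.inner_le ν z).trans
      (mul_le_mul_of_nonneg_left (hmax z (subset_closure hz)) hFν.le)
  obtain ⟨c, hbc, hcx, hnull, hne⟩ := hΩ.exists_level hν hmaxν
    (b := max 0 (F ν * r - ε)) (max_lt (by rw [hxν]; positivity) (by rw [hxν]; linarith))
  have hc0 : 0 ≤ c := (le_max_left _ _).trans hbc.le
  have hcε : F ν * r - ε ≤ c := (le_max_right _ _).trans hbc.le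
  have hcη : ∀ z, polar F z ≤ r → c ≤ ⟪z, ν⟫ → polar F (z - x) < η := fun z hz hzc =>
    hεcap z hz (hcε.trans hzc)
  have hgain := hηcap c hc0 hcη
  set Ω' := Ω ∩ {x | ⟪x, ν⟫ < c} with hΩ'
  have hadm : IsAdmissible Ω' := hΩ.inter_halfSpace hne
  set b := vol {z ∈ Ω | c < ⟪z, ν⟫} with hb
  have hVb : vol Ω' + b = V := vol_inter_halfSpace_add hΩ hν c
  have hV'0 : 0 < vol Ω' := hadm.vol_pos
  have hb0 : 0 < b := by
    have hopen : IsOpen {z ∈ Ω | c < ⟪z, ν⟫} := hΩ.isOpen.inter (isOpen_setOf_lt_inner ν c)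
    obtain ⟨z, hz, hz'⟩ := mem_closure_iff.1 hxΩ _ (isOpen_setOf_lt_inner ν c) hcx
    exact ENNReal.toReal_pos (hopen.measure_pos volume ⟨z, hz', hz⟩).ne'
      (hΩ.isBounded.subset fun y hy => hy.1).measure_lt_top.ne
  have hbV : b < u₀ * V := by
    refine hρvol _ fun z hz => ?_
    rw [mem_ball_iff_norm]
    have h1 := hcη z (hmax z (subset_closure hz.1)) (le_of_lt hz.2)
    calc ‖z - x‖ ≤ C * polar F (z - x) := hnorm _
      _ < C * η := by gcongr
      _ < ρ := by rwa [lt_div_iff₀ hC, mul_comm] at hηρ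
  have hP'0 : 0 < anisotropicPerimeter F Ω' := hF.anisotropicPerimeter_pos hn hadm
  have hP'P : anisotropicPerimeter F Ω' ≤ P := by
    have h1 := hF.cap_integral_le hΩ hν hr hx hxν c (g := fun _ => 1) continuous_const le_rfl
      (fun _ _ _ => zero_le_one) (fun _ _ _ _ _ _ => by simp)
    rw [← hF.weightedPerimeter_inter_halfSpace hΩ hν hne hnull continuous_const, zero_mul,
      ← anisotropicPerimeter_eq_weightedPerimeter, ← anisotropicPerimeter_eq_weightedPerimeter]
      at h1
    linarith
  have hgc : Continuous fun y => polar F y ^ p - θ := hwc.sub continuous_const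
  have hM'0 : boundaryMomentum p F Ω' ≤ θ * anisotropicPerimeter F Ω' - growthRate p r η * b := by
    rw [← hF.weightedPerimeter_inter_halfSpace hΩ hν hne hnull hgc,
      hF.weightedPerimeter_sub_const hΩ hwc, hF.weightedPerimeter_sub_const hadm hwc,
      ← boundaryMomentum_eq_weightedPerimeter, ← boundaryMomentum_eq_weightedPerimeter, ← hM, ← hP,
      hθ, div_mul_cancel₀ _ hP0.ne'] at hgain
    linarith
  refine ⟨Ω', hadm, ?_⟩
  have hu : b / V ∈ Ioo 0 u₀ := ⟨by positivity, by rwa [div_lt_iff₀ hV0]⟩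
  have hbern' : 1 - q' * (b / V) ≤ (1 - b / V) ^ (p / n : ℝ) := hbern hu
  have hV'q : vol Ω' ^ (p / n : ℝ) = V ^ (p / n : ℝ) * (1 - b / V) ^ (p / n : ℝ) := by
    have h1 : vol Ω' = V * (1 - b / V) := by
      field_simp
      linarith
    have h2 : 0 ≤ 1 - b / V := by
      rw [sub_nonneg, div_le_one hV0]
      linarith
    rw [h1, Real.mul_rpow hV0.le h2]
  unfold functionalF
  rw [← hM, ← hP, ← hV]
  have hVq : 0 < V ^ (p / n : ℝ) := Real.rpow_pos_of_pos hV0 _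
  have hV'q0 : 0 < vol Ω' ^ (p / n : ℝ) := Real.rpow_pos_of_pos hV'0 _
  rw [div_lt_div_iff₀ (mul_pos hP'0 hV'q0) (mul_pos hP0 hVq), hV'q]
  have hMθ : θ * P = M := div_mul_cancel₀ _ hP0.ne'
  set P' := anisotropicPerimeter F Ω'
  set κ := growthRate p r η
  have k1 : boundaryMomentum p F Ω' * P ≤ M * P' - κ * b * P := by
    nlinarith [mul_le_mul_of_nonneg_right hM'0 hP0.le]
  have k2 : M * P' * (1 - q' * (b / V)) ≤ M * P' * (1 - b / V) ^ (p / n : ℝ) := by gcongr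
  have hq'0 : 0 ≤ q' := (by positivity : (0 : ℝ) ≤ p / n).trans hq'.le
  have k3 : M * P' * (q' * (b / V)) < κ * b * P := by
    calc M * P' * (q' * (b / V)) = q' * (M / V) * b * P' := by ring
      _ ≤ q' * (M / V) * b * P := by gcongr
      _ < κ * b * P := by gcongr
  calc boundaryMomentum p F Ω' * (P * V ^ (p / n : ℝ))
      = boundaryMomentum p F Ω' * P * V ^ (p / n : ℝ) := by ring
    _ < M * P' * (1 - b / V) ^ (p / n : ℝ) * V ^ (p / n : ℝ) := by
        refine mul_lt_mul_of_pos_right ?_ hVq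
        linarith
    _ = M * (P' * (V ^ (p / n : ℝ) * (1 - b / V) ^ (p / n : ℝ))) := by ring

/-- A convex set of full volume in an open convex set is the whole set. -/
theorem IsAdmissible.eq_of_subset_of_vol_le {Ω₁ Ω₂ : Set (EuclideanSpace ℝ (Fin n))}
    (h₁ : IsAdmissible Ω₁) (h₂ : IsAdmissible Ω₂) (hsub : Ω₁ ⊆ Ω₂) (hvol : vol Ω₂ ≤ vol Ω₁) :
    Ω₁ = Ω₂ := by
  have hfin : volume Ω₂ ≠ ⊤ := h₂.isBounded.measure_lt_top.ne
  have hle : volume Ω₂ ≤ volume Ω₁ :=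
    (ENNReal.toReal_le_toReal hfin h₁.isBounded.measure_lt_top.ne).1 hvol
  have hnull : volume (Ω₂ \ Ω₁) = 0 := by
    rw [measure_sdiff hsub h₁.isOpen.measurableSet.nullMeasurableSet
      h₁.isBounded.measure_lt_top.ne, tsub_eq_zero_of_le hle]
  have hempty : Ω₂ \ closure Ω₁ = ∅ := by
    by_contra hne
    refine ((h₂.isOpen.sdiff isClosed_closure).measure_pos volume
      (nonempty_iff_ne_empty.2 hne)).ne' (measure_mono_null ?_ hnull)
    exact sdiff_subset_sdiff_right subset_closure
  refine hsub.antisymm ?_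
  have h3 : Ω₂ ⊆ interior (closure Ω₁) :=
    interior_maximal (sdiff_eq_empty.1 hempty) h₂.isOpen
  rwa [h₁.convex.interior_closure_eq_interior_of_nonempty_interior
    (by rw [h₁.isOpen.interior_eq]; exact h₁.nonempty), h₁.isOpen.interior_eq] at h3

end

theorem mainTheorem3 (n : ℕ) (hn : 2 ≤ n) (p : ℝ) (hp : 1 < p)
    (F : EuclideanSpace ℝ (Fin n) → ℝ) (hF : IsFinslerNorm p F)
    (Ω : Set (EuclideanSpace ℝ (Fin n))) (hΩ : IsAdmissible Ω)
    (hE : 0 < excess p F Ω) :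
    ¬ IsMinimizer p F Ω := by
  rintro ⟨-, hmin⟩
  suffices ∃ Ω', IsAdmissible Ω' ∧ functionalF p F Ω' < functionalF p F Ω by
    obtain ⟨Ω', hΩ', hlt⟩ := this
    exact (hmin Ω' hΩ').not_gt hlt
  have hn0 : n ≠ 0 := by omega
  obtain ⟨x, hxΩ, hx, hmax⟩ := hF.exists_polar_eq_rMax hΩ
  obtain ⟨ν, hν, hxν⟩ := hF.exists_inner_eq hn0 x
  rw [hx] at hxν
  have hr : 0 < rMax F Ω := hF.rMax_pos hn0 hΩ
  have hP0 : 0 < anisotropicPerimeter F Ω := hF.anisotropicPerimeter_pos hn0 hΩ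
  have hwc : Continuous fun y => polar F y ^ p :=
    hF.continuous_polar.rpow_const fun _ => Or.inr (by linarith)
  have hMle : ∀ Ω' : Set (EuclideanSpace ℝ (Fin n)), IsAdmissible Ω' →
      (∀ z ∈ closure Ω', polar F z ≤ rMax F Ω) →
        boundaryMomentum p F Ω' ≤ rMax F Ω ^ p * anisotropicPerimeter F Ω' := by
    intro Ω' hΩ' hle
    rw [boundaryMomentum_eq_weightedPerimeter, ← weightedPerimeter_const]
    refine hF.weightedPerimeter_mono hΩ' hwc continuous_const fun y hy => ?_
    exact Real.rpow_le_rpow (hF.polar_nonneg y) (hle y (frontier_subset_closure hy)) (by linarith)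
  rcases (hMle Ω hΩ hmax).lt_or_eq with hlt | heq
  · -- the mean value of `(F°) ^ p` over the boundary is below its maximum
    refine hF.exists_functionalF_lt_of_cap hp hn0 hΩ hE hν hxΩ hx hmax hxν ?_
    have hθ : boundaryMomentum p F Ω / anisotropicPerimeter F Ω < rMax F Ω ^ p := by
      rwa [div_lt_iff₀ hP0]
    have hcont : Filter.Tendsto (fun η : ℝ => (rMax F Ω - η) ^ p) (𝓝[>] 0)
        (𝓝 (rMax F Ω ^ p)) := by
      have h1 : Continuous fun η : ℝ => (rMax F Ω - η) ^ p :=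
        (continuous_const.sub continuous_id).rpow_const fun _ => Or.inr (by linarith)
      simpa using (h1.tendsto 0).mono_left nhdsWithin_le_nhds
    filter_upwards [hcont.eventually (lt_mem_nhds hθ),
      nhdsWithin_le_nhds (gt_mem_nhds (half_pos hr))] with η hη hηr c _ hc
    exact hF.growthRate_mul_vol_le hp hΩ hν hr hx hxν hηr hη.le
      fun z hz hzc => hc z (hmax z hz) hzc
  · -- otherwise the Wulff shape around `Ω` is a better competitor, unless it equals `Ω`
    have hW : IsAdmissible {v | polar F v < rMax F Ω} := hF.isAdmissible_polar_lt hr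
    have hWle : ∀ z ∈ closure {v | polar F v < rMax F Ω}, polar F z ≤ rMax F Ω :=
      fun z hz => closure_lt_subset_le hF.continuous_polar continuous_const hz
    have hsub : Ω ⊆ {v | polar F v < rMax F Ω} := by
      have hΩle : Ω ⊆ {v | polar F v ≤ rMax F Ω} := fun z hz => hmax z (subset_closure hz)
      intro z hz
      -- `Ω` is open, so some `s z` with `s > 1` lies in it
      have hcont : Continuous fun s : ℝ => s • z := by fun_prop
      have hev : ∀ᶠ s in 𝓝[>] (1 : ℝ), s • z ∈ Ω := nhdsWithin_le_nhds
        (hcont.continuousAt.eventually_mem (hΩ.isOpen.mem_nhds (by simpa using hz)))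
      obtain ⟨s, hs, hs1⟩ := (hev.and self_mem_nhdsWithin).exists
      have hs1 : 1 < s := hs1
      have h1 : polar F (s • z) ≤ rMax F Ω := hΩle hs
      rw [hF.polar_smul, abs_of_pos (by linarith)] at h1
      show polar F z < rMax F Ω
      by_contra! hge
      nlinarith
    rcases lt_or_ge (vol Ω) (vol {v | polar F v < rMax F Ω}) with hvol | hvol
    · refine ⟨_, hW, ?_⟩
      have hPW := hF.anisotropicPerimeter_pos hn0 hW
      have hq : 0 < p / n := div_pos (by linarith) (by exact_mod_cast Nat.pos_of_ne_zero hn0)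
      have hV0 := Real.rpow_pos_of_pos hΩ.vol_pos (p / n)
      have hVW0 := Real.rpow_pos_of_pos hW.vol_pos (p / n)
      have hVlt := Real.rpow_lt_rpow hΩ.vol_pos.le hvol hq
      have hrp := Real.rpow_pos_of_pos hr p
      unfold functionalF
      calc boundaryMomentum p F {v | polar F v < rMax F Ω} /
            (anisotropicPerimeter F {v | polar F v < rMax F Ω} *
              vol {v | polar F v < rMax F Ω} ^ (p / n : ℝ))
          ≤ rMax F Ω ^ p * anisotropicPerimeter F {v | polar F v < rMax F Ω} /
            (anisotropicPerimeter F {v | polar F v < rMax F Ω} *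
              vol {v | polar F v < rMax F Ω} ^ (p / n : ℝ)) := by
            gcongr
            exact hMle _ hW hWle
        _ = rMax F Ω ^ p / vol {v | polar F v < rMax F Ω} ^ (p / n : ℝ) := by
            field_simp
        _ < rMax F Ω ^ p / vol Ω ^ (p / n : ℝ) := by gcongr
        _ = _ := by
            rw [heq]
            field_simp
    · have hΩW := hΩ.eq_of_subset_of_vol_le hW hsub hvol
      refine hF.exists_functionalF_lt_of_cap hp hn0 hΩ hE hν hxΩ hx hmax hxν ?_
      filter_upwards [nhdsWithin_le_nhds (gt_mem_nhds (half_pos hr))] with η hηr c hc0 hc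
      have h1 := hF.growthRate_mul_vol_le_of_wulff hp hν hr hx hxν hηr hc0 hc
      rw [← hΩW] at h1
      have h2 : boundaryMomentum p F Ω / anisotropicPerimeter F Ω = rMax F Ω ^ p := by
        rw [heq, mul_div_cancel_right₀ _ hP0.ne']
      rw [h2]
      exact h1
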